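/- Let $\mathcal X\subset\mathbb R^d$ be compact and equal to the closure of its interior. For $m\in\mathbb N_0$ let $C^m(\mathcal X)$ be the set of $f:\mathcal X\to\mathbb R$ whose mixed partial derivatives $\partial^\beta f$, $|\beta|\le m$, exist in the interior of $\mathcal X$ and extend continuously to $\mathcal X$ (the extension is again denoted $\partial^\beta f$). Let $K:\mathcal X\times\mathcal X\to\mathbb R$ be a Mercer kernel (continuous, symmetric, positive semidefinite) in $C^{2m}(\mathcal X,\mathcal X)$, i.e. for all $|\beta|\le m$ the derivative $\partial^{\beta,\beta}K(x,x')=\partial^\beta_x\partial^\beta_{x'}K(x,x')$ exists in the interior and extends continuously to $\mathcal X\times\mathcal X$. Put $\kappa=\sqrt{\sup_{x\in\mathcal X}K(x,x)}$, $\kappa_\beta=\sqrt{\sup_{x\in\mathcal X}\partial^{\beta,\beta}K(x,x)}$ and $\|g\|_\infty=\sup_{x\in\mathcal X}|g(x)|$. Let $n\ge 1$ and let $(X_i,y_i)$, $1\le i\le n$, be i.i.d. with values in $\mathcal X\times\mathbb R$, let $P_X$ be the law of $X_i$, and let $y_i=f_0(X_i)+\varepsilon_i$, where $f_0\in C^m(\mathcal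 X)$, $\mathbb E[\varepsilon_i\mid X_i]=0$ and, for some $\sigma\ge0$, $\mathbb E e^{t\varepsilon_i}\le e^{\sigma^2t^2/2}$ for all $t\in\mathbb R$. Let $\lambda>0$. The kernel ridge regression estimator is $\hat f_n(x)=K(x,X)[K(X,X)+n\lambda I_n]^{-1}y$, where $K(x,X)=(K(x,X_j))_{j}$, $K(X,X)=(K(X_i,X_j))_{i,j}$ and $y=(y_1,\dots,y_n)^T$. With $(L_Kf)(x)=\int_{\mathcal X}K(x,x')f(x')\,dP_X(x')$, let $f_\lambda=(L_K+\lambda I)^{-1}L_Kf_0$, i.e. $f_\lambda$ is the unique continuous function on $\mathcal X$ with $L_Kf_\lambda+\lambda f_\lambda=L_Kf_0$ (it exists). Then $\hat f_n$ and $f_\lambda$ belong to $C^m(\mathcal X)$. Moreover, for every $\delta_0\in(0,1)$ there is a constant $C>0$ depending only on $\delta_0$ (in particular not on $K$, $n$, $d$, $m$, $\mathcal X$, $f_0$, $\sigma$, $\lambda$ or the law of the data) such that, for every multi-index $\beta$ with $|\beta|\le m$ and every $\delta\in(0,\delta_0]$, with probability at least $1-\delta$, $$\|\partial^\beta\hat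 f_n-\partial^\beta f_0\|_\infty\le\|\partial^\beta f_\lambda-\partial^\beta f_0\|_\infty+\frac{2\kappa\kappa_\beta M\sqrt{\log(1/\delta)}}{\sqrt n\,\lambda}\left(10+2C+\frac{8\kappa\sqrt{\log(1/\delta)}}{3\sqrt{n\lambda}}\right),$$ where $M=\max\{\|f_0\|_\infty,\sigma\}$. -/

import Mathlib

open MeasureTheory ProbabilityTheory Set
open scoped NNReal

noncomputable section

/-- The mixed partial derivative `∂₁^{β₁} ⋯ ∂_d^{β_d} f` of a function on `ℝ^d`
(`lineDeriv ℝ g x (Pi.single j 1)` is the partial derivative of `g` in the `j`-th coordinate). -/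
def mixedPartial {d : ℕ} (β : Fin d → ℕ) (f : (Fin d → ℝ) → ℝ) : (Fin d → ℝ) → ℝ :=
  (List.finRange d).foldr
    (fun j g => (fun h x => lineDeriv ℝ h x (Pi.single j 1))^[β j] g) f

/-- `∂^β f` as a function on a compact set `S` that is the closure of its interior: the derivative
is taken in the interior and extended to the boundary by continuity. -/
def mixedPartialOn {d : ℕ} (S : Set (Fin d → ℝ)) (β : Fin d → ℕ)
    (f : (Fin d → ℝ) → ℝ) : (Fin d → ℝ) → ℝ :=
  extendFrom (interior S) (mixedPartial β f)

/-- `∂^{β,β} K (x, x') = ∂_x^β ∂_{x'}^β K (x, x')` on `S × S`: taken in the interior and extended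
by continuity. -/
def kernelPartialOn {d : ℕ} (S : Set (Fin d → ℝ)) (β : Fin d → ℕ)
    (K : (Fin d → ℝ) → (Fin d → ℝ) → ℝ) : (Fin d → ℝ) × (Fin d → ℝ) → ℝ :=
  extendFrom (interior S ×ˢ interior S)
    (fun p => mixedPartial β (fun x => mixedPartial β (fun x' => K x x') p.2) p.1)

/-- `f ∈ C^m(S)`: all mixed partial derivatives `D β = ∂^β f` with `|β| ≤ m` exist in the interior
of `S` and extend to continuous functions on `S`. -/
def IsCm {d : ℕ} (S : Set (Fin d → ℝ)) (m : ℕ) (f : (Fin d → ℝ) → ℝ) : Prop :=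
  ∃ D : (Fin d → ℕ) → (Fin d → ℝ) → ℝ,
    EqOn (D 0) f S ∧
    (∀ β, ∑ i, β i ≤ m → ContinuousOn (D β) S) ∧
    ∀ (β : Fin d → ℕ) (j : Fin d), ∑ i, (β + Pi.single j 1 : Fin d → ℕ) i ≤ m → ∀ x ∈ interior S,
      HasLineDerivAt ℝ (D β) (D (β + Pi.single j 1) x) x (Pi.single j 1)

/-- `K ∈ C^{2m}(S, S)`: for every `|γ| ≤ m` the derivative `∂^{γ,γ} K` exists in the interior and
extends to a continuous function on `S × S`. Here `D α β = ∂_x^α ∂_{x'}^β K`, and the condition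
`∑ i, max (α i) (β i) ≤ m` says that `D α β` is one of the derivatives through which some
`∂^{γ,γ} K` with `|γ| ≤ m` is formed (`α ≤ γ` and `β ≤ γ`). Continuity is asked of the
`∂^{γ,γ} K` only. -/
def IsC2m {d : ℕ} (S : Set (Fin d → ℝ)) (m : ℕ) (K : (Fin d → ℝ) → (Fin d → ℝ) → ℝ) : Prop :=
  ∃ D : (Fin d → ℕ) → (Fin d → ℕ) → (Fin d → ℝ) → (Fin d → ℝ) → ℝ,
    (∀ x ∈ S, ∀ x' ∈ S, D 0 0 x x' = K x x') ∧
    (∀ γ, ∑ i, γ i ≤ m → ContinuousOn (fun p : (Fin d → ℝ) × (Fin d → ℝ) => D γ γ p.1 p.2)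
      (S ×ˢ S)) ∧
    (∀ (α β : Fin d → ℕ) (j : Fin d), ∑ i, max (α i) ((β + Pi.single j 1 : Fin d → ℕ) i) ≤ m →
      ∀ x ∈ interior S, ∀ x' ∈ interior S,
        HasLineDerivAt ℝ (fun z => D α β x z) (D α (β + Pi.single j 1) x x') x'
          (Pi.single j 1)) ∧
    (∀ (α β : Fin d → ℕ) (j : Fin d), ∑ i, max ((α + Pi.single j 1 : Fin d → ℕ) i) (β i) ≤ m →
      ∀ x ∈ interior S, ∀ x' ∈ interior S,
        HasLineDerivAt ℝ (fun z => D α β z x') (D (α + Pi.single j 1) β x x') x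
          (Pi.single j 1))

/-- A Mercer kernel on `S`: continuous, symmetric and positive (semi)definite. -/
structure IsMercerKernel {d : ℕ} (S : Set (Fin d → ℝ))
    (K : (Fin d → ℝ) → (Fin d → ℝ) → ℝ) : Prop where
  continuousOn : ContinuousOn (fun p : (Fin d → ℝ) × (Fin d → ℝ) => K p.1 p.2) (S ×ˢ S)
  symm : ∀ x ∈ S, ∀ x' ∈ S, K x x' = K x' x
  nonneg : ∀ (N : ℕ) (x : Fin N → Fin d → ℝ) (c : Fin N → ℝ), (∀ i, x i ∈ S) →
    0 ≤ ∑ i, ∑ j, c i * c j * K (x i) (x j)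

/-- The sup norm over `S`. -/
def supNormOn {d : ℕ} (S : Set (Fin d → ℝ)) (f : (Fin d → ℝ) → ℝ) : ℝ :=
  ⨆ x : S, |f x|

/-- `κ = (sup_{x ∈ S} K(x, x))^{1/2}`. -/
def kappa {d : ℕ} (S : Set (Fin d → ℝ)) (K : (Fin d → ℝ) → (Fin d → ℝ) → ℝ) : ℝ :=
  Real.sqrt (⨆ x : S, K x x)

/-- `κ_β = (sup_{x ∈ S} ∂^{β,β} K(x, x))^{1/2}`. -/
def kappaDeriv {d : ℕ} (S : Set (Fin d → ℝ)) (β : Fin d → ℕ)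
    (K : (Fin d → ℝ) → (Fin d → ℝ) → ℝ) : ℝ :=
  Real.sqrt (⨆ x : S, kernelPartialOn S β K (x, x))

/-- The integral operator `(L_K f)(x) = ∫ K(x, x') f(x') dP_X(x')`. -/
def integralOp {d : ℕ} (PX : Measure (Fin d → ℝ)) (K : (Fin d → ℝ) → (Fin d → ℝ) → ℝ)
    (f : (Fin d → ℝ) → ℝ) : (Fin d → ℝ) → ℝ :=
  fun x => ∫ x', K x x' * f x' ∂PX

/-- `f = (L_K + lam I)⁻¹ L_K f₀` on `S`: `f` is a continuous solution of
`(L_K + lam I) f = L_K f₀`. -/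
def IsRegularized {d : ℕ} (S : Set (Fin d → ℝ)) (PX : Measure (Fin d → ℝ))
    (K : (Fin d → ℝ) → (Fin d → ℝ) → ℝ) (lam : ℝ) (f₀ f : (Fin d → ℝ) → ℝ) : Prop :=
  ContinuousOn f S ∧ ∀ x ∈ S, integralOp PX K f x + lam * f x = integralOp PX K f₀ x

/-- The kernel ridge regression estimator `x ↦ K(x, X) [K(X, X) + n lam I]⁻¹ y`. -/
def krr {d n : ℕ} (K : (Fin d → ℝ) → (Fin d → ℝ) → ℝ) (lam : ℝ)
    (X : Fin n → Fin d → ℝ) (y : Fin n → ℝ) : (Fin d → ℝ) → ℝ :=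
  fun x => (fun j => K x (X j)) ⬝ᵥ
    Matrix.mulVec
      (Matrix.of (fun i j => K (X i) (X j)) + ((n : ℝ) * lam) • (1 : Matrix (Fin n) (Fin n) ℝ))⁻¹ y

/-- `(X_i, y_i)`, `i < n`, are independent observations with common law `P₀` on `S × ℝ`, with
regression function `f₀`, that is `E[y_i - f₀(X_i) | X_i] = 0`, and with errors `y_i - f₀(X_i)`
that are sub-Gaussian with variance proxy `σ²`. -/
structure IsRegressionSample {d n : ℕ} {Ω : Type*} [MeasurableSpace Ω] (μ : Measure Ω)
    (S : Set (Fin d → ℝ)) (P₀ : Measure ((Fin d → ℝ) × ℝ)) (f₀ : (Fin d → ℝ) → ℝ) (σ : ℝ≥0)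
    (X : Fin n → Ω → Fin d → ℝ) (y : Fin n → Ω → ℝ) : Prop where
  measurable_X : ∀ i, Measurable (X i)
  measurable_y : ∀ i, Measurable (y i)
  mem : ∀ i ω, X i ω ∈ S
  indep : iIndepFun (fun i ω => (X i ω, y i ω)) μ
  law : ∀ i, μ.map (fun ω => (X i ω, y i ω)) = P₀
  regression : ∀ i, μ[fun ω => y i ω - f₀ (X i ω) | MeasurableSpace.comap (X i) inferInstance]
    =ᵐ[μ] 0
  subgaussian : ∀ i, HasSubgaussianMGF (fun ω => y i ω - f₀ (X i ω)) (σ ^ 2) μ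

end

/-! ### Feature maps of kernels and their differentiability. -/

section FeatureMap

open Filter
open scoped Topology

/-! Everything takes place in one Hilbert space `H` with a feature map `Φ` of `K`, in which the
estimator is `x ↦ ⟪Φ x, fh⟫` and f_λ is `x ↦ ⟪Φ x, u⟫`. On the interior, inner products of
difference quotients of `Φ` are second difference quotients of `K`; they converge, and a family
whose mutual inner products converge to one constant is Cauchy. So `Φ` has derivatives `W β` in `H`
with Gram kernel ∂^{β,β}K (`exists_smooth_featureMap`). Hence each `⟪Φ ·, h⟫` is in C^m with β-th
derivative `⟪W β ·, h⟫`, and by Cauchy–Schwarz the β-th derivatives of the estimator and of f_λ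
differ by at most κ_β ‖fh - u‖. A single estimate in `H` thus serves every β.

The vector `u` solves the population normal equation and `fh` the empirical one. Subtracting them
and pairing with `fh - u` gives ‖fh - u‖ ≤ ‖R‖/(nλ), with R = ∑ ((y_i - ⟪Φ X_i, u⟫) Φ X_i - λu)
(`norm_ridge_sub_le`). This R is a sum of i.i.d. centred vectors, each splitting into the noise ε_i
Φ X_i, dominated by a sub-Gaussian variable, and (f₀ - f_λ)(X_i) Φ X_i - λu, which is bounded with
second moment at most (κM)².

Both sums are controlled by Pinelis's method: by `cosh_norm_add_le`, adding an independent centred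
vector multiplies E cosh ‖sum‖ by a factor of at most 1 + E(e^‖x‖ - 1 - ‖x‖). The resulting tails
carry a prefactor 2, while the total failure probability must be exactly δ. The prefactors are
absorbed using log(1/δ) ≥ log(1/δ₀) > 0, which is why C depends on δ₀ and grows as δ₀ → 1. -/

/-- A symmetric positive semidefinite kernel has a feature map with dense span. -/
theorem exists_total_featureMap {U : Type} (k : U → U → ℝ) (hsymm : ∀ x y, k x y = k y x)
    (hnonneg : ∀ (N : ℕ) (x : Fin N → U) (c : Fin N → ℝ),
      0 ≤ ∑ i, ∑ j, c i * c j * k (x i) (x j)) :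
    ∃ (H : Type) (_ : NormedAddCommGroup H) (_ : InnerProductSpace ℝ H) (_ : CompleteSpace H)
      (Φ : U → H), (∀ x y, inner ℝ (Φ x) (Φ y) = k x y) ∧
        ∀ h : H, (∀ x, inner ℝ h (Φ x) = 0) → h = 0 := by
  let M : Matrix U U (ℝ →L[ℝ] ℝ) := Matrix.of fun x y => k x y • ContinuousLinearMap.id ℝ ℝ
  have hM : M.PosSemidef := by
    have htfae := (RKHS.posSemidef_tfae (𝕜 := ℝ) (K := M)).out 0 1
    refine htfae.mpr ⟨?_, fun f => ?_⟩
    · ext x y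
      simp [M, Matrix.conjTranspose_apply, hsymm x y,
        ← ContinuousLinearMap.one_def]
    -- The test function `f` lives on pairs (point, scalar). Giving the point `p.1` the weight `f p
    -- * p.2` turns its quadratic form into an instance of `hnonneg`, where points may repeat.
    · have h := hnonneg f.support.card (fun i => (f.support.equivFin.symm i).1.1)
        (fun i => f (f.support.equivFin.symm i).1 * (f.support.equivFin.symm i).1.2)
      have h2 : ∀ g : U × ℝ → U × ℝ → ℝ, ∑ i, ∑ j, g (f.support.equivFin.symm i).1
          (f.support.equivFin.symm j).1 = ∑ p ∈ f.support, ∑ q ∈ f.support, g p q := by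
        intro g
        rw [f.support.equivFin.symm.sum_comp (fun p : f.support =>
          ∑ j, g p (f.support.equivFin.symm j).1),
          Finset.sum_coe_sort f.support (fun p => ∑ j, g p (f.support.equivFin.symm j).1)]
        refine Finset.sum_congr rfl fun p _ => ?_
        rw [f.support.equivFin.symm.sum_comp (fun q : f.support => g p q),
          Finset.sum_coe_sort f.support (g p)]
      rw [h2 fun p q => f p * p.2 * (f q * q.2) * k p.1 q.1] at h
      change 0 ≤ ∑ p ∈ f.support, ∑ q ∈ f.support, f p * f q * inner ℝ (k q.1 p.1 • p.2) q.2
      refine h.trans_eq (Finset.sum_congr rfl fun p _ => Finset.sum_congr rfl fun q _ => ?_)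
      simp [hsymm p.1 q.1]
      ring
  have : Fact M.PosSemidef := ⟨hM⟩
  refine ⟨RKHS.OfKernel M, inferInstance, inferInstance, inferInstance,
    fun x => RKHS.kerFun (RKHS.OfKernel M) x 1, fun x y => ?_, fun h hh => ?_⟩
  · rw [← RKHS.kernel_inner, RKHS.OfKernel.kernel_ofKernel]
    simp [M, hsymm x y]
  · refine RKHS.ext fun x => ?_
    have := hh x
    rw [RKHS.inner_kerFun] at this
    simpa using this

variable {H : Type*} [NormedAddCommGroup H] [InnerProductSpace ℝ H] [CompleteSpace H]

/-- A family converges along a filter as soon as its Gram matrix does. -/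
theorem exists_tendsto_of_tendsto_inner {ι : Type*} {l : Filter ι} [NeBot l] {F : ι → H} {c : ℝ}
    (h : Tendsto (fun p : ι × ι => inner ℝ (F p.1) (F p.2)) (l ×ˢ l) (𝓝 c)) :
    ∃ v, Tendsto F l (𝓝 v) := by
  have h1 : Tendsto (fun p : ι × ι => inner ℝ (F p.1) (F p.1)) (l ×ˢ l) (𝓝 c) :=
    h.comp (tendsto_fst.prodMk tendsto_fst)
  have h2 : Tendsto (fun p : ι × ι => inner ℝ (F p.2) (F p.2)) (l ×ˢ l) (𝓝 c) :=
    h.comp (tendsto_snd.prodMk tendsto_snd)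
  -- Under the root stands ‖F s - F t‖², whose three terms share the limit `c`, so it tends to c -
  -- 2c + c = 0.
  have h3 : Tendsto (fun p : ι × ι => √(inner ℝ (F p.1) (F p.1) - 2 * inner ℝ (F p.1) (F p.2)
      + inner ℝ (F p.2) (F p.2))) (l ×ˢ l) (𝓝 0) := by
    have := ((h1.sub (h.const_mul 2)).add h2).sqrt
    rwa [show c - 2 * c + c = 0 by ring, Real.sqrt_zero] at this
  have h4 : Cauchy (map F l) := by
    refine cauchy_map_iff.mpr ⟨‹_›, ?_⟩
    rw [tendsto_uniformity_iff_dist_tendsto_zero]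
    refine h3.congr fun p => ?_
    rw [dist_eq_norm, ← Real.sqrt_sq (norm_nonneg (F p.1 - F p.2)), norm_sub_sq_real,
      real_inner_self_eq_norm_sq, real_inner_self_eq_norm_sq]
  exact cauchy_map_iff_exists_tendsto.mp h4

/-- The mean value theorem between `0` and a point of either sign. -/
theorem exists_sub_eq_deriv_mul {φ φ' : ℝ → ℝ} {δ h : ℝ} (hh : |h| < δ)
    (hφ : ∀ s, |s| < δ → HasDerivAt φ (φ' s) s) : ∃ s, |s| < δ ∧ φ h - φ 0 = φ' s * h := by
  rw [abs_lt] at hh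
  rcases lt_trichotomy h 0 with h0 | h0 | h0
  · have hd : ∀ s ∈ Icc h 0, HasDerivAt φ (φ' s) s := fun s hs =>
      hφ s (abs_lt.mpr ⟨by linarith [hs.1], by linarith [hs.2]⟩)
    obtain ⟨s, hs, hs'⟩ := exists_hasDerivAt_eq_slope φ φ' h0
      (fun s hs => (hd s hs).continuousAt.continuousWithinAt)
      (fun s hs => hd s (Ioo_subset_Icc_self hs))
    refine ⟨s, abs_lt.mpr ⟨by linarith [hs.1], by linarith [hs.2]⟩, ?_⟩
    rw [hs']
    have : h ≠ 0 := h0.ne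
    field_simp
    ring
  · exact ⟨0, by simpa using by linarith, by simp [h0]⟩
  · have hd : ∀ s ∈ Icc 0 h, HasDerivAt φ (φ' s) s := fun s hs =>
      hφ s (abs_lt.mpr ⟨by linarith [hs.1], by linarith [hs.2]⟩)
    obtain ⟨s, hs, hs'⟩ := exists_hasDerivAt_eq_slope φ φ' h0
      (fun s hs => (hd s hs).continuousAt.continuousWithinAt)
      (fun s hs => hd s (Ioo_subset_Icc_self hs))
    refine ⟨s, abs_lt.mpr ⟨by linarith [hs.1], by linarith [hs.2]⟩, ?_⟩
    rw [hs']
    have : h ≠ 0 := h0.ne'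
    field_simp
    ring

variable {E : Type*} [NormedAddCommGroup E] [NormedSpace ℝ E]

theorem HasLineDerivAt.hasDerivAt_comp_add {F : Type*} [NormedAddCommGroup F] [NormedSpace ℝ F]
    {f : E → F} {f' : F} {x e : E} {s : ℝ}
    (h : HasLineDerivAt ℝ f f' (x + s • e) e) : HasDerivAt (fun t : ℝ => f (x + t • e)) f' s := by
  have h' : HasDerivAt (fun t : ℝ => f (x + s • e + t • e)) f' (s - s) := by
    rw [sub_self]; exact h
  have := h'.comp_sub_const s s
  refine this.congr_of_eventuallyEq (Eventually.of_forall fun t => ?_)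
  simp only
  congr 1
  rw [sub_smul]; abel

/-- The second difference quotients converge to the mixed second derivative. -/
theorem tendsto_second_difference_quotient {U : Set E} (hU : IsOpen U) {e : E} {A B C : E → E → ℝ}
    (hB : ∀ x ∈ U, ∀ x' ∈ U, HasLineDerivAt ℝ (fun z => A x z) (B x x') x' e)
    (hC : ∀ x ∈ U, ∀ x' ∈ U, HasLineDerivAt ℝ (fun z => B z x') (C x x') x e)
    (hCc : ContinuousOn (fun p : E × E => C p.1 p.2) (U ×ˢ U)) {x x' : E} (hx : x ∈ U)
    (hx' : x' ∈ U) :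
    Tendsto (fun p : ℝ × ℝ => p.1⁻¹ * p.2⁻¹ * (A (x + p.1 • e) (x' + p.2 • e) - A x (x' + p.2 • e)
      - A (x + p.1 • e) x' + A x x')) (𝓝[≠] 0 ×ˢ 𝓝[≠] 0) (𝓝 (C x x')) := by
  have hCx : Tendsto (fun p : ℝ × ℝ => C (x + p.1 • e) (x' + p.2 • e)) (𝓝 (0, 0))
      (𝓝 (C x x')) := by
    have h1 : ContinuousAt (fun p : E × E => C p.1 p.2) (x, x') :=
      hCc.continuousAt ((hU.prod hU).mem_nhds ⟨hx, hx'⟩)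
    have h2 : Tendsto (fun p : ℝ × ℝ => (x + p.1 • e, x' + p.2 • e)) (𝓝 (0, 0)) (𝓝 (x, x')) := by
      have : Continuous fun p : ℝ × ℝ => (x + p.1 • e, x' + p.2 • e) := by fun_prop
      simpa using this.tendsto (0, 0)
    exact h1.tendsto.comp h2
  have hUx : ∀ {x : E}, x ∈ U → ∀ᶠ s : ℝ in 𝓝 0, x + s • e ∈ U := by
    intro x hx
    have : Continuous fun s : ℝ => x + s • e := by fun_prop
    exact this.continuousAt.eventually_mem (hU.mem_nhds (by simpa using hx))
  rw [Metric.tendsto_nhds]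
  intro ε hε
  obtain ⟨δ₁, hδ₁, h1⟩ := Metric.eventually_nhds_iff.mp (Metric.tendsto_nhds.mp hCx ε hε)
  obtain ⟨δ₂, hδ₂, h2⟩ := Metric.eventually_nhds_iff.mp (hUx hx)
  obtain ⟨δ₃, hδ₃, h3⟩ := Metric.eventually_nhds_iff.mp (hUx hx')
  simp only [dist_zero_right, Real.norm_eq_abs] at h2 h3
  set δ := min δ₁ (min δ₂ δ₃) with hδ
  have hδ0 : 0 < δ := by positivity
  have hball : ∀ᶠ s : ℝ in 𝓝[≠] 0, s ≠ 0 ∧ |s| < δ := by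
    refine eventually_mem_nhdsWithin.and (mem_nhdsWithin_of_mem_nhds ?_)
    exact Metric.eventually_nhds_iff.mpr ⟨δ, hδ0, fun y hy => by simpa using hy⟩
  refine (hball.prod_mk hball).mono ?_
  rintro ⟨h, h'⟩ ⟨⟨hh0, hh⟩, hh0', hh'⟩
  simp only at hh0 hh hh0' hh' ⊢
  have hin : ∀ s : ℝ, |s| < δ → x + s • e ∈ U := fun s hs =>
    h2 (hs.trans_le ((min_le_right _ _).trans (min_le_left _ _)))
  have hin' : ∀ s : ℝ, |s| < δ → x' + s • e ∈ U := fun s hs =>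
    h3 (hs.trans_le ((min_le_right _ _).trans (min_le_right _ _)))
  -- Two mean value steps, in the second variable for the difference of `A` and then in the first
  -- for `B`, turn the quotient into a value of `C` at a nearby point. Only `C` has to be
  -- continuous.
  obtain ⟨t, ht, ht'⟩ := exists_sub_eq_deriv_mul
    (φ := fun t => A (x + h • e) (x' + t • e) - A x (x' + t • e))
    (φ' := fun t => B (x + h • e) (x' + t • e) - B x (x' + t • e)) hh' fun s hs =>
      ((hB _ (hin h hh) _ (hin' s hs)).hasDerivAt_comp_add).sub
        ((hB _ hx _ (hin' s hs)).hasDerivAt_comp_add)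
  obtain ⟨s, hs, hs'⟩ := exists_sub_eq_deriv_mul
    (φ := fun s => B (x + s • e) (x' + t • e))
    (φ' := fun s => C (x + s • e) (x' + t • e)) hh fun s hs =>
      (hC _ (hin s hs) _ (hin' t ht)).hasDerivAt_comp_add
  simp only [zero_smul, add_zero] at ht' hs'
  have hval : h⁻¹ * h'⁻¹ * (A (x + h • e) (x' + h' • e) - A x (x' + h' • e)
      - A (x + h • e) x' + A x x') = C (x + s • e) (x' + t • e) := by
    rw [show A (x + h • e) (x' + h' • e) - A x (x' + h' • e) - A (x + h • e) x' + A x x'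
      = A (x + h • e) (x' + h' • e) - A x (x' + h' • e) - (A (x + h • e) x' - A x x') by ring,
      ht', hs']
    field_simp
  rw [hval]
  refine @h1 (s, t) ?_
  rw [Prod.dist_eq]
  simp only [dist_zero_right, Real.norm_eq_abs]
  exact max_lt (hs.trans_le (min_le_left _ _)) (ht.trans_le (min_le_left _ _))

/-- A map into a Hilbert space is differentiable along `e` if its Gram kernel has a continuous
mixed derivative, which is the Gram kernel of the derivative. -/
theorem exists_hasLineDerivAt_of_gram {U : Set E} (hU : IsOpen U) {e : E} {A B C : E → E → ℝ}
    (hB : ∀ x ∈ U, ∀ x' ∈ U, HasLineDerivAt ℝ (fun z => A x z) (B x x') x' e)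
    (hC : ∀ x ∈ U, ∀ x' ∈ U, HasLineDerivAt ℝ (fun z => B z x') (C x x') x e)
    (hCc : ContinuousOn (fun p : E × E => C p.1 p.2) (U ×ˢ U)) {V : E → H}
    (hV : ∀ x ∈ U, ∀ x' ∈ U, inner ℝ (V x) (V x') = A x x') :
    ∃ V' : E → H, (∀ x ∈ U, HasLineDerivAt ℝ V (V' x) x e) ∧
      ∀ x ∈ U, ∀ x' ∈ U, inner ℝ (V' x) (V' x') = C x x' := by
  have hUx : ∀ {x : E}, x ∈ U → ∀ᶠ s : ℝ in 𝓝[≠] 0, x + s • e ∈ U := by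
    intro x hx
    have : Continuous fun s : ℝ => x + s • e := by fun_prop
    exact mem_nhdsWithin_of_mem_nhds
      (this.continuousAt.eventually_mem (hU.mem_nhds (by simpa using hx)))
  -- With `x = x'` this makes the difference quotients of `V` Cauchy; with `x ≠ x'` it identifies
  -- the Gram kernel of their limits.
  have key : ∀ x ∈ U, ∀ x' ∈ U, Tendsto (fun p : ℝ × ℝ =>
      inner ℝ (p.1⁻¹ • (V (x + p.1 • e) - V x)) (p.2⁻¹ • (V (x' + p.2 • e) - V x')))
      (𝓝[≠] 0 ×ˢ 𝓝[≠] 0) (𝓝 (C x x')) := by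
    intro x hx x' hx'
    refine (tendsto_second_difference_quotient hU hB hC hCc hx hx').congr' ?_
    refine ((hUx hx).prod_mk (hUx hx')).mono fun p hp => ?_
    beta_reduce
    rw [real_inner_smul_left, real_inner_smul_right, inner_sub_left, inner_sub_right,
      inner_sub_right, hV _ hp.1 _ hp.2, hV _ hp.1 _ hx', hV _ hx _ hp.2, hV _ hx _ hx']
    ring
  have hlim : ∀ x, ∃ v, x ∈ U → Tendsto (fun s : ℝ => s⁻¹ • (V (x + s • e) - V x)) (𝓝[≠] 0)
      (𝓝 v) := by
    intro x
    by_cases hx : x ∈ U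
    · obtain ⟨v, hv⟩ := exists_tendsto_of_tendsto_inner (l := 𝓝[≠] (0 : ℝ))
        (F := fun s : ℝ => s⁻¹ • (V (x + s • e) - V x)) (key x hx x hx)
      exact ⟨v, fun _ => hv⟩
    · exact ⟨0, fun h => absurd h hx⟩
  choose V' hV' using hlim
  refine ⟨V', fun x hx => ?_, fun x hx x' hx' => ?_⟩
  · rw [HasLineDerivAt, hasDerivAt_iff_tendsto_slope_zero]
    simpa using hV' x hx
  · exact tendsto_nhds_unique
      (((hV' x hx).comp tendsto_fst).inner ((hV' x' hx').comp tendsto_snd)) (key x hx x' hx')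

end FeatureMap

/-! ### Mixed partial derivatives and the smooth feature map. -/

section Derivatives

open Filter
open scoped Topology

variable {d : ℕ}

theorem sum_add_single (β : Fin d → ℕ) (j : Fin d) :
    ∑ i, (β + Pi.single j 1 : Fin d → ℕ) i = ∑ i, β i + 1 := by
  simp [Finset.sum_add_distrib, Pi.single_apply]

theorem iterate_lineDeriv_eqOn {U : Set (Fin d → ℝ)} (hU : IsOpen U)
    {G : (Fin d → ℕ) → (Fin d → ℝ) → ℝ} {α : Fin d → ℕ} {j : Fin d} {g : (Fin d → ℝ) → ℝ}
    (hg : EqOn g (G α) U) (k : ℕ)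
    (hG : ∀ i < k, ∀ x ∈ U, HasLineDerivAt ℝ (G (α + Pi.single j i))
      (G (α + Pi.single j (i + 1)) x) x (Pi.single j 1)) :
    EqOn ((fun h x => lineDeriv ℝ h x (Pi.single j 1))^[k] g) (G (α + Pi.single j k)) U := by
  induction k with
  | zero => simpa using hg
  | succ k ih =>
    have ih := ih fun i hi => hG i (hi.trans k.lt_succ_self)
    intro x hx
    rw [Function.iterate_succ_apply']
    have hev := ih.eventuallyEq_of_mem (hU.mem_nhds hx)
    rw [hev.lineDeriv_eq]
    exact (hG k k.lt_succ_self x hx).lineDeriv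

/-- A family of functions linked by partial derivatives computes the mixed partial derivatives of
its first member. -/
theorem mixedPartial_eqOn {U : Set (Fin d → ℝ)} (hU : IsOpen U)
    {G : (Fin d → ℕ) → (Fin d → ℝ) → ℝ} {f : (Fin d → ℝ) → ℝ} {β : Fin d → ℕ}
    (h0 : EqOn f (G 0) U)
    (hG : ∀ (α : Fin d → ℕ) (j : Fin d), α + Pi.single j 1 ≤ β → ∀ x ∈ U,
      HasLineDerivAt ℝ (G α) (G (α + Pi.single j 1) x) x (Pi.single j 1)) :
    EqOn (mixedPartial β f) (G β) U := by
  -- Once the coordinates of `l` have been treated, the multi-index is β restricted to `l`. Absence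
  -- of repetitions makes the entry at the next coordinate start from zero.
  have key : ∀ l : List (Fin d), l.Nodup → EqOn (l.foldr
      (fun j g => (fun h x => lineDeriv ℝ h x (Pi.single j 1))^[β j] g) f)
      (G fun i => if i ∈ l then β i else 0) U := by
    intro l hl
    induction l with
    | nil => simpa [Pi.zero_def] using h0
    | cons j l ih =>
      rw [List.nodup_cons] at hl
      have h1 := iterate_lineDeriv_eqOn (j := j) hU (ih hl.2) (β j) ?_
      · rw [List.foldr_cons]
        convert h1 using 2
        ext i
        by_cases hij : i = j
        · subst hij; simp [hl.1]
        · simp [hij]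
      · intro k hk x hx
        rw [Pi.single_add, ← add_assoc]
        refine hG _ j (fun i => ?_) x hx
        by_cases hij : i = j
        · subst hij; simpa [hl.1] using hk
        · by_cases hil : i ∈ l <;> simp [hij, hil]
  have := key _ (List.nodup_finRange d)
  simpa [mixedPartial] using this

/-- The extended derivatives of a function in `C^m` are the members of any family witnessing it. -/
theorem mixedPartialOn_eqOn {S : Set (Fin d → ℝ)} (hS : closure (interior S) = S) {m : ℕ}
    {D : (Fin d → ℕ) → (Fin d → ℝ) → ℝ} {f : (Fin d → ℝ) → ℝ} (h0 : EqOn (D 0) f S)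
    (hc : ∀ β, ∑ i, β i ≤ m → ContinuousOn (D β) S)
    (hD : ∀ (β : Fin d → ℕ) (j : Fin d), ∑ i, (β + Pi.single j 1 : Fin d → ℕ) i ≤ m →
      ∀ x ∈ interior S, HasLineDerivAt ℝ (D β) (D (β + Pi.single j 1) x) x (Pi.single j 1))
    {β : Fin d → ℕ} (hβ : ∑ i, β i ≤ m) : EqOn (mixedPartialOn S β f) (D β) S := by
  intro x hx
  refine extendFrom_eq (hS.symm ▸ hx) ?_
  have h1 : EqOn (mixedPartial β f) (D β) (interior S) :=
    mixedPartial_eqOn isOpen_interior (h0.symm.mono interior_subset) fun α j hα =>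
      hD α j ((Finset.sum_le_sum fun i _ => hα i).trans hβ)
  exact ((hc β hβ x hx).mono interior_subset).congr' (h1.symm.eventuallyEq_of_mem
    self_mem_nhdsWithin)

/-- `∂^{β,β} K` is the member `D β β` of any family witnessing `K ∈ C^{2m}`. -/
theorem kernelPartialOn_eq {S : Set (Fin d → ℝ)} (hS : closure (interior S) = S) {m : ℕ}
    {K : (Fin d → ℝ) → (Fin d → ℝ) → ℝ}
    {D : (Fin d → ℕ) → (Fin d → ℕ) → (Fin d → ℝ) → (Fin d → ℝ) → ℝ}
    (h0 : ∀ x ∈ S, ∀ x' ∈ S, D 0 0 x x' = K x x')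
    (hc : ∀ γ, ∑ i, γ i ≤ m → ContinuousOn (fun p : (Fin d → ℝ) × (Fin d → ℝ) => D γ γ p.1 p.2)
      (S ×ˢ S))
    (h2 : ∀ (α β : Fin d → ℕ) (j : Fin d),
      ∑ i, max (α i) ((β + Pi.single j 1 : Fin d → ℕ) i) ≤ m →
      ∀ x ∈ interior S, ∀ x' ∈ interior S,
        HasLineDerivAt ℝ (fun z => D α β x z) (D α (β + Pi.single j 1) x x') x' (Pi.single j 1))
    (h1 : ∀ (α β : Fin d → ℕ) (j : Fin d),
      ∑ i, max ((α + Pi.single j 1 : Fin d → ℕ) i) (β i) ≤ m →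
      ∀ x ∈ interior S, ∀ x' ∈ interior S,
        HasLineDerivAt ℝ (fun z => D α β z x') (D (α + Pi.single j 1) β x x') x (Pi.single j 1))
    {β : Fin d → ℕ} (hβ : ∑ i, β i ≤ m) {x x' : Fin d → ℝ} (hx : x ∈ S) (hx' : x' ∈ S) :
    kernelPartialOn S β K (x, x') = D β β x x' := by
  have hU := isOpen_interior (s := S)
  have hin : ∀ x ∈ interior S, EqOn (mixedPartial β fun x' => K x x') (D 0 β x) (interior S) := by
    intro x hx
    refine mixedPartial_eqOn (G := fun β x' => D 0 β x x') hU
      (fun x' hx' => (h0 x (interior_subset hx) x' (interior_subset hx')).symm) fun α j hα x' hx' =>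
      h2 0 α j ((Finset.sum_le_sum fun i _ => ?_).trans hβ) x hx x' hx'
    simpa using hα i
  have hout : EqOn (fun p : (Fin d → ℝ) × (Fin d → ℝ) =>
      mixedPartial β (fun x => mixedPartial β (fun x' => K x x') p.2) p.1)
      (fun p => D β β p.1 p.2) (interior S ×ˢ interior S) := by
    rintro ⟨x, x'⟩ ⟨hx, hx'⟩
    refine mixedPartial_eqOn (G := fun α x => D α β x x') hU (fun x hx => hin x hx hx')
      (fun α j hα x hx => h1 α β j ((Finset.sum_le_sum fun i _ => ?_).trans hβ) x hx x' hx') hx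
    exact max_le (hα i) le_rfl
  refine extendFrom_eq ?_ ?_
  · rw [closure_prod_eq, hS]; exact ⟨hx, hx'⟩
  · exact ((hc β hβ (x, x') ⟨hx, hx'⟩).mono (prod_mono interior_subset interior_subset)).congr'
      (hout.symm.eventuallyEq_of_mem self_mem_nhdsWithin)

theorem HasLineDerivAt.inner_const {E H : Type*} [NormedAddCommGroup E] [NormedSpace ℝ E]
    [NormedAddCommGroup H] [InnerProductSpace ℝ H] {V : E → H} {v : H} {x e : E}
    (h : HasLineDerivAt ℝ V v x e) (w : H) :
    HasLineDerivAt ℝ (fun z => inner ℝ (V z) w) (inner ℝ v w) x e := by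
  have := HasDerivAt.inner ℝ h (hasDerivAt_const (0 : ℝ) w)
  simpa [HasLineDerivAt] using this

/-- A kernel in `C^{2m}` has a feature map `W 0` with derivatives `W β` for `|β| ≤ m` in its
Hilbert space, and the Gram kernel of `W β` is `∂^{β,β} K`. -/
theorem exists_smooth_featureMap {S : Set (Fin d → ℝ)} (hS : closure (interior S) = S) {m : ℕ}
    {K : (Fin d → ℝ) → (Fin d → ℝ) → ℝ} (hK : IsMercerKernel S K) (hKm : IsC2m S m K) :
    ∃ (H : Type) (_ : NormedAddCommGroup H) (_ : InnerProductSpace ℝ H) (_ : CompleteSpace H)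
      (W : (Fin d → ℕ) → (Fin d → ℝ) → H),
      (∀ β, ∑ i, β i ≤ m → ContinuousOn (W β) S) ∧
      (∀ (β : Fin d → ℕ) (j : Fin d), ∑ i, (β + Pi.single j 1 : Fin d → ℕ) i ≤ m →
        ∀ x ∈ interior S, HasLineDerivAt ℝ (W β) (W (β + Pi.single j 1) x) x (Pi.single j 1)) ∧
      (∀ β, ∑ i, β i ≤ m → ∀ x ∈ S, ∀ x' ∈ S,
        inner ℝ (W β x) (W β x') = kernelPartialOn S β K (x, x')) ∧
      ∀ x ∈ S, ∀ x' ∈ S, inner ℝ (W 0 x) (W 0 x') = K x x' := by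
  obtain ⟨D, h0, hc, h2, h1⟩ := hKm
  have hU := isOpen_interior (s := S)
  have hUS : interior S ⊆ S := interior_subset
  -- The space is built over the interior alone, where the derivatives live. Totality of `Φ` there
  -- is what later identifies vectors.
  obtain ⟨H, _, _, _, Φ, hΦ, hdense⟩ := exists_total_featureMap
    (fun x y : interior S => K x y)
    (fun x y => hK.symm x (hUS x.2) y (hUS y.2))
    (fun N x c => hK.nonneg N (fun i => x i) c fun i => hUS (x i).2)
  -- The inner products with `Φ u` are carried along because they determine a vector; the Gram
  -- kernel of `V` alone determines it only up to an isometry.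
  have hstep : ∀ (α : Fin d → ℕ) (j : Fin d), ∑ i, (α + Pi.single j 1 : Fin d → ℕ) i ≤ m →
      ∀ V : (Fin d → ℝ) → H,
      (∀ x ∈ interior S, ∀ x' ∈ interior S, inner ℝ (V x) (V x') = D α α x x') →
      (∀ x ∈ interior S, ∀ u : interior S, inner ℝ (V x) (Φ u) = D α 0 x u) →
      ∃ V' : (Fin d → ℝ) → H,
        (∀ x ∈ interior S, HasLineDerivAt ℝ V (V' x) x (Pi.single j 1)) ∧
        (∀ x ∈ interior S, ∀ x' ∈ interior S,
          inner ℝ (V' x) (V' x') = D (α + Pi.single j 1) (α + Pi.single j 1) x x') ∧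
        ∀ x ∈ interior S, ∀ u : interior S,
          inner ℝ (V' x) (Φ u) = D (α + Pi.single j 1) 0 x u := by
    intro α j hα V hV hVΦ
    obtain ⟨V', hV', hgram⟩ := exists_hasLineDerivAt_of_gram hU
      (h2 α α j ((Finset.sum_le_sum fun i _ => by simp).trans hα))
      (h1 α (α + Pi.single j 1) j ((Finset.sum_le_sum fun i _ => by simp).trans hα))
      ((hc _ hα).mono (prod_mono hUS hUS)) hV
    refine ⟨V', hV', hgram, fun x hx u => ?_⟩
    have hd1 := (hV' x hx).inner_const (Φ u)
    have hd2 := h1 α 0 j ((Finset.sum_le_sum fun i _ => by simp).trans hα) x hx u u.2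
    have hev : (fun z => inner ℝ (V z) (Φ u)) =ᶠ[𝓝 x] fun z => D α 0 z u :=
      eventually_of_mem (hU.mem_nhds hx) fun z hz => hVΦ z hz u
    have hd3 := hd2.congr_of_eventuallyEq hev
    rw [← hd1.lineDeriv, hd3.lineDeriv]
  have hex : ∀ (k : ℕ) (γ : Fin d → ℕ), ∑ i, γ i = k → k ≤ m → ∃ V : (Fin d → ℝ) → H,
      (∀ x ∈ interior S, ∀ x' ∈ interior S, inner ℝ (V x) (V x') = D γ γ x x') ∧
      ∀ x ∈ interior S, ∀ u : interior S, inner ℝ (V x) (Φ u) = D γ 0 x u := by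
    intro k
    induction k with
    | zero =>
      intro γ hγ _
      have hγ0 : γ = 0 := by
        ext i
        simpa using (Finset.sum_eq_zero_iff.mp hγ) i (Finset.mem_univ i)
      subst hγ0
      classical
      refine ⟨fun x => if hx : x ∈ interior S then Φ ⟨x, hx⟩ else 0, fun x hx x' hx' => ?_,
        fun x hx u => ?_⟩
      · simp only [hx, hx', dif_pos, hΦ, h0 x (hUS hx) x' (hUS hx')]
      · simp only [hx, dif_pos, hΦ, h0 x (hUS hx) u (hUS u.2)]
    | succ k ih =>
      intro γ hγ hk
      obtain ⟨j, hj⟩ : ∃ j, γ j ≠ 0 := by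
        by_contra! h
        simp [h] at hγ
      have hγj : γ - Pi.single j 1 + Pi.single j 1 = γ := by
        refine tsub_add_cancel_of_le fun i => ?_
        by_cases hij : i = j
        · subst hij; simpa using Nat.one_le_iff_ne_zero.mpr hj
        · simp [hij]
      generalize γ - Pi.single j 1 = α at hγj
      subst hγj
      rw [sum_add_single] at hγ
      obtain ⟨V, hV, hVΦ⟩ := ih α (by omega) (by omega)
      obtain ⟨V', -, h3, h4⟩ := hstep α j (by rw [sum_add_single]; omega) V hV hVΦ
      exact ⟨V', h3, h4⟩
  have hex' : ∀ γ : Fin d → ℕ, ∃ V : (Fin d → ℝ) → H, ∑ i, γ i ≤ m →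
      (∀ x ∈ interior S, ∀ x' ∈ interior S, inner ℝ (V x) (V x') = D γ γ x x') ∧
      ∀ x ∈ interior S, ∀ u : interior S, inner ℝ (V x) (Φ u) = D γ 0 x u := by
    intro γ
    by_cases hγ : ∑ i, γ i ≤ m
    · obtain ⟨V, hV⟩ := hex _ γ rfl hγ
      exact ⟨V, fun _ => hV⟩
    · exact ⟨0, fun h => absurd h hγ⟩
  choose V hV using hex'
  have hderiv : ∀ (α : Fin d → ℕ) (j : Fin d), ∑ i, (α + Pi.single j 1 : Fin d → ℕ) i ≤ m →
      ∀ x ∈ interior S, HasLineDerivAt ℝ (V α) (V (α + Pi.single j 1) x) x (Pi.single j 1) := by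
    intro α j hα x hx
    have hα' : ∑ i, α i ≤ m := by rw [sum_add_single] at hα; omega
    obtain ⟨V', h3, -, h5⟩ := hstep α j hα (V α) (hV α hα').1 (hV α hα').2
    -- The chosen `V (α + e_j)` may have been reached by differentiating in another order. Equal
    -- inner products with the total family `Φ` show that the order is immaterial.
    have : V (α + Pi.single j 1) x = V' x := by
      rw [← sub_eq_zero]
      refine hdense _ fun u => ?_
      rw [inner_sub_left, (hV _ hα).2 x hx u, h5 x hx u, sub_self]
    rw [this]
    exact h3 x hx
  have hne : ∀ x ∈ S, (𝓝[interior S] x).NeBot := fun x hx =>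
    mem_closure_iff_nhdsWithin_neBot.mp (hS.symm ▸ hx)
  have hDlim : ∀ γ : Fin d → ℕ, ∑ i, γ i ≤ m → ∀ x ∈ S, ∀ x' ∈ S,
      Tendsto (fun p : (Fin d → ℝ) × (Fin d → ℝ) => inner ℝ (V γ p.1) (V γ p.2))
        (𝓝[interior S] x ×ˢ 𝓝[interior S] x') (𝓝 (D γ γ x x')) := by
    intro γ hγ x hx x' hx'
    have h3 := (hc γ hγ (x, x') ⟨hx, hx'⟩).mono (prod_mono hUS hUS)
    rw [ContinuousWithinAt, nhdsWithin_prod_eq] at h3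
    refine h3.congr' ?_
    have h4 : ∀ y : Fin d → ℝ, ∀ᶠ z in 𝓝[interior S] y, z ∈ interior S := fun _ =>
      self_mem_nhdsWithin
    exact ((h4 x).prod_mk (h4 x')).mono fun p hp => ((hV γ hγ).1 _ hp.1 _ hp.2).symm
  have hVlim : ∀ γ : Fin d → ℕ, ∑ i, γ i ≤ m → ∀ x ∈ S,
      Tendsto (V γ) (𝓝[interior S] x) (𝓝 (extendFrom (interior S) (V γ) x)) := fun γ hγ x hx =>
    have := hne x hx
    tendsto_extendFrom (exists_tendsto_of_tendsto_inner (hDlim γ hγ x hx x hx))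
  have hgram : ∀ γ : Fin d → ℕ, ∑ i, γ i ≤ m → ∀ x ∈ S, ∀ x' ∈ S,
      inner ℝ (extendFrom (interior S) (V γ) x) (extendFrom (interior S) (V γ) x')
        = D γ γ x x' := by
    intro γ hγ x hx x' hx'
    have := hne x hx
    have := hne x' hx'
    exact tendsto_nhds_unique (((hVlim γ hγ x hx).comp tendsto_fst).inner
      ((hVlim γ hγ x' hx').comp tendsto_snd)) (hDlim γ hγ x hx x' hx')
  -- Continuity of `V γ` is not yet known. The limit and the value at `x` have the same norm squared
  -- `D γ γ x x`, which is also their inner product, so they coincide.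
  have hext : ∀ γ : Fin d → ℕ, ∑ i, γ i ≤ m → EqOn (extendFrom (interior S) (V γ)) (V γ)
      (interior S) := by
    intro γ hγ x hx
    have := hne x (hUS hx)
    have h3 : Tendsto (fun z => inner ℝ (V γ z) (V γ x)) (𝓝[interior S] x) (𝓝 (D γ γ x x)) := by
      have h4 : ContinuousWithinAt (fun z => D γ γ z x) (interior S) x :=
        (((hc γ hγ).mono (prod_mono hUS hUS)) (x, x) ⟨hx, hx⟩).comp
          (f := fun z => (z, x)) (by fun_prop) fun z hz => ⟨hz, hx⟩
      exact h4.congr' (eventually_of_mem self_mem_nhdsWithin fun z hz =>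
        ((hV γ hγ).1 z hz x hx).symm)
    have h5 := tendsto_nhds_unique ((hVlim γ hγ x (hUS hx)).inner tendsto_const_nhds) h3
    rw [← sub_eq_zero, ← norm_eq_zero, ← sq_eq_zero_iff, norm_sub_sq_real, h5,
      ← real_inner_self_eq_norm_sq, ← real_inner_self_eq_norm_sq, hgram γ hγ x (hUS hx) x (hUS hx),
      (hV γ hγ).1 x hx x hx]
    ring
  refine ⟨H, inferInstance, inferInstance, inferInstance,
    fun γ => extendFrom (interior S) (V γ), fun β hβ => ?_, fun β j hβ x hx => ?_,
    fun β hβ x hx x' hx' => ?_, fun x hx x' hx' => ?_⟩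
  · exact continuousOn_extendFrom hS.ge fun x hx => ⟨_, hVlim β hβ x hx⟩
  · have hβ' : ∑ i, β i ≤ m := by rw [sum_add_single] at hβ; omega
    beta_reduce
    rw [hext _ hβ hx]
    exact (hderiv β j hβ x hx).congr_of_eventuallyEq
      ((hext β hβ').eventuallyEq_of_mem (hU.mem_nhds hx))
  · rw [kernelPartialOn_eq hS h0 hc h2 h1 hβ hx hx', hgram β hβ x hx x' hx']
  · rw [hgram 0 (by simp) x hx x' hx', h0 x hx x' hx']

end Derivatives

/-! ### One-step exponential inequality and its iteration over independent vectors. -/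

section Concentration

variable {H : Type*} [NormedAddCommGroup H] [InnerProductSpace ℝ H]

/-- The function cosh ∘ √ is convex on [0, ∞) because its power series ∑ x^k/(2k)! has nonnegative
coefficients. -/
theorem cosh_sqrt_convex_combination_le {A B s t : ℝ} (hA : 0 ≤ A) (hB : 0 ≤ B) (hs : 0 ≤ s)
    (ht : 0 ≤ t) (hst : s + t = 1) :
    Real.cosh √(s * A + t * B) ≤ s * Real.cosh √A + t * Real.cosh √B := by
  have hpow : ∀ {x : ℝ}, 0 ≤ x → ∀ k : ℕ, √x ^ (2 * k) = x ^ k := fun hx k => by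
    rw [pow_mul, Real.sq_sqrt hx]
  refine hasSum_le (fun k => ?_) (Real.hasSum_cosh _)
    (((Real.hasSum_cosh √A).mul_left s).add ((Real.hasSum_cosh √B).mul_left t))
  rw [hpow (by positivity), hpow hA, hpow hB]
  have h := (convexOn_pow k).2 (x := A) hA (y := B) hB hs ht hst
  simp only [smul_eq_mul] at h
  calc (s * A + t * B) ^ k / ((2 * k).factorial : ℝ)
      ≤ (s * A ^ k + t * B ^ k) / ((2 * k).factorial : ℝ) := by gcongr
    _ = _ := by ring

/-- The one-step inequality behind Pinelis's exponential bound. -/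
theorem cosh_norm_add_le (u x : H) :
    Real.cosh ‖u + x‖ ≤ Real.cosh ‖u‖ * (1 + (Real.exp ‖x‖ - 1 - ‖x‖))
      + Real.sinh ‖u‖ / ‖u‖ * inner ℝ u x := by
  set p := ‖u‖
  set r := ‖x‖
  set t := inner ℝ u x / (p * r) with ht
  have hp : 0 ≤ p := norm_nonneg u
  have hr : 0 ≤ r := norm_nonneg x
  have hux : inner ℝ u x = p * r * t := by
    rcases eq_or_ne (p * r) 0 with h | h
    · have := abs_real_inner_le_norm u x
      rw [show ‖u‖ * ‖x‖ = 0 from h] at this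
      rw [h, zero_mul]
      exact abs_nonpos_iff.mp this
    · rw [ht, mul_div_assoc']
      exact (mul_div_cancel_left₀ _ h).symm
  have ht1 : |t| ≤ 1 := abs_real_inner_div_norm_mul_norm_le_one u x
  rw [abs_le] at ht1
  -- With `t` the cosine of the angle, ‖u + x‖² is a convex combination of the two collinear cases
  -- (p + r)² and (p - r)².
  have hnorm : ‖u + x‖ = √((1 + t) / 2 * (p + r) ^ 2 + (1 - t) / 2 * (p - r) ^ 2) := by
    rw [← Real.sqrt_sq (norm_nonneg (u + x)), norm_add_sq_real, hux]
    congr 1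
    ring
  have hcoef : Real.sinh p / p * (p * r * t) = Real.sinh p * r * t := by
    rcases eq_or_ne p 0 with h | h
    · simp [h]
    · field_simp
  have h1 := cosh_sqrt_convex_combination_le (sq_nonneg (p + r)) (sq_nonneg (p - r))
    (by linarith : 0 ≤ (1 + t) / 2) (by linarith : 0 ≤ (1 - t) / 2) (by ring)
  rw [Real.sqrt_sq_eq_abs, Real.sqrt_sq_eq_abs, Real.cosh_abs, Real.cosh_abs, Real.cosh_add,
    Real.cosh_sub] at h1
  rw [hnorm, hux, hcoef, ← Real.cosh_add_sinh r]
  refine h1.trans ?_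
  have h2 : r ≤ Real.sinh r := Real.self_le_sinh_iff.mpr hr
  have h3 : t * Real.sinh p ≤ Real.cosh p := by
    have h4 : 0 ≤ Real.sinh p := Real.sinh_nonneg_iff.mpr hp
    nlinarith [Real.sinh_lt_cosh p]
  -- The remaining gap is exactly (sinh r - r)(cosh p - t sinh p).
  nlinarith [mul_nonneg (sub_nonneg.mpr h2) (sub_nonneg.mpr h3)]

variable {Z : Type*} [MeasurableSpace Z]

/-- Iterating a one-step inequality `Ψ (u + x) ≤ Ψ u (1 + ψ x) + ⟪g u, x⟫` over independent centred
vectors. -/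
theorem integral_pi_sum_le [CompleteSpace H] {ν : Measure Z} [IsProbabilityMeasure ν] {F : Z → H}
    (hF : StronglyMeasurable F) (hFi : Integrable F ν) (hF0 : ∫ z, F z ∂ν = 0) {Ψ ψ : H → ℝ}
    {g : ℝ → ℝ} (hΨ : Continuous Ψ) (hΨ0 : Ψ 0 = 1) (hΨnn : ∀ u, 0 ≤ Ψ u)
    (hψ : Integrable (fun z => ψ (F z)) ν) (hψnn : ∀ x, 0 ≤ ψ x) (hg : Measurable g)
    (hgΨ : ∀ u : H, |g ‖u‖| * ‖u‖ ≤ Ψ u)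
    (hstep : ∀ u x, Ψ (u + x) ≤ Ψ u * (1 + ψ x) + g ‖u‖ * inner ℝ u x) (n : ℕ) :
    Integrable (fun z : Fin n → Z => Ψ (∑ i, F (z i))) (Measure.pi fun _ => ν) ∧
      ∫ z : Fin n → Z, Ψ (∑ i, F (z i)) ∂(Measure.pi fun _ => ν) ≤ (1 + ∫ z, ψ (F z) ∂ν) ^ n := by
  induction n with
  | zero => simp [hΨ0]
  | succ n ih =>
    obtain ⟨ih1, ih2⟩ := ih
    set P : Measure (Fin n → Z) := Measure.pi fun _ => ν
    set T : (Fin n → Z) → H := fun z => ∑ i, F (z i)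
    have hT : StronglyMeasurable T :=
      Finset.stronglyMeasurable_fun_sum _ fun i _ => hF.comp_measurable (measurable_pi_apply i)
    have hT2 : StronglyMeasurable fun p : Z × (Fin n → Z) => T p.2 :=
      hT.comp_measurable measurable_snd
    have hF2 : StronglyMeasurable fun p : Z × (Fin n → Z) => F p.1 :=
      hF.comp_measurable measurable_fst
    have hψ1 : Integrable (fun z => 1 + ψ (F z)) ν := (integrable_const 1).add hψ
    have hB1 : Integrable (fun p : Z × (Fin n → Z) => (1 + ψ (F p.1)) * Ψ (T p.2)) (ν.prod P) :=
      hψ1.mul_prod ih1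
    -- The hypothesis `hgΨ` serves here: it dominates the linear term by ‖F‖ Ψ(T), a product of
    -- integrable functions of separate variables.
    have hB2 : Integrable (fun p : Z × (Fin n → Z) => g ‖T p.2‖ * inner ℝ (T p.2) (F p.1))
        (ν.prod P) := by
      refine (hFi.norm.mul_prod ih1).mono' ?_ (Filter.Eventually.of_forall fun p => ?_)
      · exact ((hg.comp hT2.norm.measurable).stronglyMeasurable.mul
          (hT2.inner hF2)).aestronglyMeasurable
      · rw [norm_mul, Real.norm_eq_abs, Real.norm_eq_abs]
        calc |g ‖T p.2‖| * |inner ℝ (T p.2) (F p.1)| ≤ |g ‖T p.2‖| * (‖T p.2‖ * ‖F p.1‖) := by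
              gcongr; exact abs_real_inner_le_norm _ _
          _ = ‖F p.1‖ * (|g ‖T p.2‖| * ‖T p.2‖) := by ring
          _ ≤ ‖F p.1‖ * Ψ (T p.2) := by gcongr; exact hgΨ _
    have hle : ∀ p : Z × (Fin n → Z), Ψ (F p.1 + T p.2) ≤ (1 + ψ (F p.1)) * Ψ (T p.2)
        + g ‖T p.2‖ * inner ℝ (T p.2) (F p.1) := fun p => by
      rw [add_comm (F p.1), mul_comm (1 + _)]; exact hstep _ _
    have hR : Integrable (fun p : Z × (Fin n → Z) => Ψ (F p.1 + T p.2)) (ν.prod P) := by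
      refine (hB1.add hB2).mono' ?_ (Filter.Eventually.of_forall fun p => ?_)
      · exact (hΨ.comp_stronglyMeasurable (hF2.add hT2)).aestronglyMeasurable
      · rw [Real.norm_of_nonneg (hΨnn _)]; exact hle p
    -- Integrating over the new variable first kills the linear term, since `F` is centred.
    have hzero : ∫ p, g ‖T p.2‖ * inner ℝ (T p.2) (F p.1) ∂(ν.prod P) = 0 := by
      rw [integral_prod_symm _ hB2]
      refine integral_eq_zero_of_ae (Filter.Eventually.of_forall fun y => ?_)
      simp only [Pi.zero_apply]
      rw [integral_const_mul, integral_inner hFi, hF0, inner_zero_right, mul_zero]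
    have hint : ∫ p, Ψ (F p.1 + T p.2) ∂(ν.prod P) ≤ (1 + ∫ z, ψ (F z) ∂ν) ^ (n + 1) := by
      calc ∫ p, Ψ (F p.1 + T p.2) ∂(ν.prod P)
          ≤ ∫ p, ((1 + ψ (F p.1)) * Ψ (T p.2) + g ‖T p.2‖ * inner ℝ (T p.2) (F p.1)) ∂(ν.prod P) :=
            integral_mono hR (hB1.add hB2) hle
        _ = (1 + ∫ z, ψ (F z) ∂ν) * ∫ z, Ψ (T z) ∂P := by
            rw [integral_add hB1 hB2, hzero, add_zero,
              integral_prod_mul (fun z => 1 + ψ (F z)) fun z => Ψ (T z),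
              integral_add (integrable_const 1) hψ]
            simp
        _ ≤ (1 + ∫ z, ψ (F z) ∂ν) * (1 + ∫ z, ψ (F z) ∂ν) ^ n := by
            have : 0 ≤ ∫ z, ψ (F z) ∂ν := integral_nonneg fun z => hψnn _
            gcongr
        _ = _ := (pow_succ' _ _).symm
    have hmp := measurePreserving_piFinSuccAbove (fun _ : Fin (n + 1) => ν) 0
    have hcomp : (fun z : Fin (n + 1) → Z => Ψ (∑ i, F (z i)))
        = (fun p : Z × (Fin n → Z) => Ψ (F p.1 + T p.2)) ∘
          (MeasurableEquiv.piFinSuccAbove (fun _ => Z) 0) := by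
      ext z
      simp [Fin.sum_univ_succ, T, MeasurableEquiv.piFinSuccAbove, Fin.insertNthEquiv, Fin.tail]
    refine ⟨?_, ?_⟩
    · rw [hcomp]
      exact (hmp.integrable_comp_emb (MeasurableEquiv.measurableEmbedding _)).mpr hR
    · rw [hcomp]
      refine le_trans (le_of_eq ?_) hint
      exact hmp.integral_comp' (fun p : Z × (Fin n → Z) => Ψ (F p.1 + T p.2))

end Concentration

/-! ### Tail bounds: exponential, Chebyshev, sub-Gaussian, Bernstein. -/

section Tails

variable {Z : Type*} [MeasurableSpace Z] {ν : Measure Z}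

/-- Expressing an event about an i.i.d. sample through the product measure. -/
theorem real_lt_norm_sum_eq_pi {Ω : Type*} [MeasurableSpace Ω] {μ : Measure Ω}
    [IsProbabilityMeasure μ] {H : Type*} [NormedAddCommGroup H] {F : Z → H} {n : ℕ}
    {X : Fin n → Ω → Z} (hX : ∀ i, Measurable (X i))
    (hind : iIndepFun X μ) (hlaw : ∀ i, μ.map (X i) = ν) (hF : StronglyMeasurable F) (r : ℝ) :
    μ.real {ω | r < ‖∑ i, F (X i ω)‖}
      = (Measure.pi fun _ : Fin n => ν).real {z | r < ‖∑ i, F (z i)‖} := by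
  have h1 := (iIndepFun_iff_map_fun_eq_pi_map fun i => (hX i).aemeasurable).mp hind
  simp only [hlaw] at h1
  have hT : StronglyMeasurable fun z : Fin n → Z => ∑ i, F (z i) :=
    Finset.stronglyMeasurable_fun_sum _ fun i _ => hF.comp_measurable (measurable_pi_apply i)
  rw [← h1, map_measureReal_apply (measurable_pi_iff.mpr hX)
    (measurableSet_lt measurable_const hT.norm.measurable)]
  rfl

theorem exp_sub_one_sub_id_le_sq_mul_exp {y : ℝ} (hy : 0 ≤ y) :
    Real.exp y - 1 - y ≤ y ^ 2 * Real.exp y := by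
  have h1 : Real.exp y - 1 ≤ y * Real.exp y := by
    have h2 := Real.add_one_le_exp (-y)
    have h3 : Real.exp (-y) * Real.exp y = 1 := by rw [← Real.exp_add]; simp
    nlinarith [Real.exp_pos y]
  nlinarith [Real.exp_pos y]

theorem exp_sub_one_sub_id_mono {x y : ℝ} (hx : 0 ≤ x) (hxy : x ≤ y) :
    Real.exp x - 1 - x ≤ Real.exp y - 1 - y := by
  have h1 := Real.add_one_le_exp (y - x)
  have h2 : Real.exp y = Real.exp x * Real.exp (y - x) := by rw [← Real.exp_add]; simp
  have h3 := Real.one_le_exp hx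
  nlinarith

variable {e : Z → ℝ} {σ : ℝ≥0}

theorem integrable_exp_mul_abs_of_subgaussian (he : HasSubgaussianMGF e (σ ^ 2) ν) (s : ℝ) :
    Integrable (fun z => Real.exp (s * |e z|)) ν := by
  refine ((he.integrable_exp_mul s).add (he.integrable_exp_mul (-s))).mono' ?_
    (Filter.Eventually.of_forall fun z => ?_)
  · exact (Real.continuous_exp.comp_aestronglyMeasurable
      (he.aestronglyMeasurable.norm.const_mul s))
  · rw [Real.norm_of_nonneg (Real.exp_pos _).le, Pi.add_apply]
    rcases abs_cases (e z) with h | h <;> rw [h.1]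
    · linarith [Real.exp_pos (-s * e z)]
    · rw [mul_neg, ← neg_mul]
      linarith [Real.exp_pos (s * e z)]

theorem integral_exp_mul_abs_le_of_subgaussian (he : HasSubgaussianMGF e (σ ^ 2) ν) (s : ℝ) :
    ∫ z, Real.exp (s * |e z|) ∂ν ≤ 2 * Real.exp (s ^ 2 * σ ^ 2 / 2) := by
  have h1 := he.mgf_le s
  have h2 := he.mgf_le (-s)
  rw [mgf] at h1 h2
  push_cast at h1 h2
  calc ∫ z, Real.exp (s * |e z|) ∂ν
      ≤ ∫ z, (Real.exp (s * e z) + Real.exp (-s * e z)) ∂ν := by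
        refine integral_mono (integrable_exp_mul_abs_of_subgaussian he s)
          ((he.integrable_exp_mul s).add (he.integrable_exp_mul (-s))) fun z => ?_
        simp only
        rcases abs_cases (e z) with h | h <;> rw [h.1]
        · linarith [Real.exp_pos (-s * e z)]
        · rw [mul_neg, ← neg_mul]
          linarith [Real.exp_pos (s * e z)]
    _ = ∫ z, Real.exp (s * e z) ∂ν + ∫ z, Real.exp (-s * e z) ∂ν :=
        integral_add (he.integrable_exp_mul s) (he.integrable_exp_mul (-s))
    _ ≤ Real.exp (σ ^ 2 * s ^ 2 / 2) + Real.exp (σ ^ 2 * (-s) ^ 2 / 2) := add_le_add h1 h2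
    _ = _ := by rw [neg_sq, mul_comm (s ^ 2)]; ring

variable {H : Type*} [NormedAddCommGroup H] [InnerProductSpace ℝ H] [CompleteSpace H]
  [IsProbabilityMeasure ν] {F : Z → H}

/-- Pinelis's exponential bound for sums of independent centred vectors. -/
theorem pi_real_lt_norm_sum_le_exp (hF : StronglyMeasurable F) (hFi : Integrable F ν)
    (hF0 : ∫ z, F z ∂ν = 0) {τ c r : ℝ} (hτ : 0 < τ)
    (hexp : Integrable (fun z => Real.exp (τ * ‖F z‖)) ν)
    (hc : 1 + ∫ z, (Real.exp (τ * ‖F z‖) - 1 - τ * ‖F z‖) ∂ν ≤ Real.exp c) (n : ℕ) :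
    (Measure.pi fun _ : Fin n => ν).real {z | r < ‖∑ i, F (z i)‖}
      ≤ 2 * Real.exp (n * c - τ * r) := by
  have hnorm : ∀ z, ‖τ • F z‖ = τ * ‖F z‖ := fun z => by
    rw [norm_smul, Real.norm_of_nonneg hτ.le]
  have hψnn : ∀ x : H, 0 ≤ Real.exp ‖x‖ - 1 - ‖x‖ := fun x => by
    linarith [Real.add_one_le_exp ‖x‖]
  have hψ : Integrable (fun z => Real.exp ‖τ • F z‖ - 1 - ‖τ • F z‖) ν := by
    simp only [hnorm]
    exact (hexp.sub (integrable_const 1)).sub (hFi.norm.const_mul τ)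
  obtain ⟨h1, h2⟩ := integral_pi_sum_le (F := fun z => τ • F z) (hF.const_smul τ) (hFi.smul τ)
    (by rw [integral_smul, hF0, smul_zero]) (Ψ := fun u : H => Real.cosh ‖u‖)
    (ψ := fun x : H => Real.exp ‖x‖ - 1 - ‖x‖) (g := fun p => Real.sinh p / p)
    (Real.continuous_cosh.comp continuous_norm) (by simp) (fun u => (Real.cosh_pos _).le) hψ hψnn
    (Real.continuous_sinh.measurable.div measurable_id) (fun u => by
      have h0 : 0 ≤ Real.sinh ‖u‖ := Real.sinh_nonneg_iff.mpr (norm_nonneg u)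
      rw [abs_of_nonneg (div_nonneg h0 (norm_nonneg u))]
      rw [div_mul_cancel_of_imp fun h => by rw [h, Real.sinh_zero]]
      exact (Real.sinh_lt_cosh _).le)
    cosh_norm_add_le n
  simp only [hnorm] at h2
  -- Markov's inequality for cosh; cosh x ≥ e^x/2 is the source of the prefactor 2.
  have h3 := mul_meas_ge_le_integral_of_nonneg
    (Filter.Eventually.of_forall fun z => (Real.cosh_pos _).le) h1 (Real.exp (τ * r) / 2)
  have h4 : (Measure.pi fun _ : Fin n => ν).real {z | r < ‖∑ i, F (z i)‖}
      ≤ (Measure.pi fun _ : Fin n => ν).real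
        {z | Real.exp (τ * r) / 2 ≤ Real.cosh ‖∑ i, τ • F (z i)‖} := by
    refine measureReal_mono fun z hz => ?_
    simp only [mem_ofPred_eq] at hz ⊢
    rw [← Finset.smul_sum, norm_smul, Real.norm_of_nonneg hτ.le, Real.cosh_eq]
    have : Real.exp (τ * r) ≤ Real.exp (τ * ‖∑ i, F (z i)‖) := by gcongr
    linarith [Real.exp_pos (-(τ * ‖∑ i, F (z i)‖))]
  have h5 : (1 + ∫ z, (Real.exp (τ * ‖F z‖) - 1 - τ * ‖F z‖) ∂ν) ^ n ≤ Real.exp (n * c) := by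
    rw [Real.exp_nat_mul]
    have : 0 ≤ ∫ z, (Real.exp (τ * ‖F z‖) - 1 - τ * ‖F z‖) ∂ν :=
      integral_nonneg fun z => sub_nonneg.mpr
        (le_sub_iff_add_le.mpr (Real.add_one_le_exp (τ * ‖F z‖)))
    gcongr
  rw [Real.exp_sub, ← mul_div_assoc, le_div_iff₀ (Real.exp_pos _)]
  nlinarith [Real.exp_pos (τ * r)]

/-- Chebyshev's inequality for sums of independent centred vectors, up to a constant. -/
theorem pi_real_lt_norm_sum_le_div (hF : StronglyMeasurable F) (hFi : Integrable F ν)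
    (hF0 : ∫ z, F z ∂ν = 0) {v r : ℝ} (hv : 0 < v) (hr : 0 < r)
    (hsq : Integrable (fun z => ‖F z‖ ^ 2) ν) (hle : ∫ z, ‖F z‖ ^ 2 ∂ν ≤ v) {n : ℕ} (hn : 1 ≤ n) :
    (Measure.pi fun _ : Fin n => ν).real {z | r < ‖∑ i, F (z i)‖}
      ≤ Real.exp 1 * (n * v) / r ^ 2 := by
  have hn0 : (0 : ℝ) < n := by exact_mod_cast hn
  -- This scaling makes the product (1 + τ²v)^n at most e.
  set τ := √(1 / (n * v)) with hτ
  have hτ2 : τ ^ 2 = 1 / (n * v) := Real.sq_sqrt (by positivity)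
  have hnorm : ∀ z, ‖τ • F z‖ ^ 2 = τ ^ 2 * ‖F z‖ ^ 2 := fun z => by
    rw [norm_smul, Real.norm_of_nonneg (Real.sqrt_nonneg _), mul_pow]
  obtain ⟨h1, h2⟩ := integral_pi_sum_le (F := fun z => τ • F z) (hF.const_smul τ) (hFi.smul τ)
    (by rw [integral_smul, hF0, smul_zero]) (Ψ := fun u : H => 1 + ‖u‖ ^ 2)
    (ψ := fun x : H => ‖x‖ ^ 2) (g := fun _ => 2) (by fun_prop) (by simp)
    (fun u => by positivity) (by simp only [hnorm]; exact hsq.const_mul _)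
    (fun x => by positivity) measurable_const
    (fun u => by rw [abs_of_pos two_pos]; nlinarith [sq_nonneg (1 - ‖u‖)])
    (fun u x => by rw [norm_add_sq_real]; nlinarith [mul_nonneg (sq_nonneg ‖u‖) (sq_nonneg ‖x‖)]) n
  simp only [hnorm] at h2
  rw [integral_const_mul] at h2
  have h3 := mul_meas_ge_le_integral_of_nonneg
    (Filter.Eventually.of_forall fun z => by positivity) h1 (τ ^ 2 * r ^ 2)
  have h4 : (Measure.pi fun _ : Fin n => ν).real {z | r < ‖∑ i, F (z i)‖}
      ≤ (Measure.pi fun _ : Fin n => ν).real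
        {z | τ ^ 2 * r ^ 2 ≤ 1 + ‖∑ i, τ • F (z i)‖ ^ 2} := by
    refine measureReal_mono fun z hz => ?_
    simp only [mem_ofPred_eq] at hz ⊢
    rw [← Finset.smul_sum, norm_smul, Real.norm_of_nonneg (Real.sqrt_nonneg _), mul_pow]
    have : τ ^ 2 * r ^ 2 ≤ τ ^ 2 * ‖∑ i, F (z i)‖ ^ 2 := by gcongr
    linarith
  have h5 : (1 + τ ^ 2 * ∫ z, ‖F z‖ ^ 2 ∂ν) ^ n ≤ Real.exp 1 := by
    have h6 : 0 ≤ ∫ z, ‖F z‖ ^ 2 ∂ν := integral_nonneg fun z => by positivity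
    calc (1 + τ ^ 2 * ∫ z, ‖F z‖ ^ 2 ∂ν) ^ n ≤ (1 + τ ^ 2 * v) ^ n := by gcongr
      _ ≤ Real.exp (τ ^ 2 * v) ^ n := by
          gcongr; linarith [Real.add_one_le_exp (τ ^ 2 * v)]
      _ = Real.exp 1 := by
          rw [← Real.exp_nat_mul, hτ2]; congr 1; field_simp
  rw [le_div_iff₀ (by positivity)]
  have h7 : τ ^ 2 * r ^ 2 * (Measure.pi fun _ : Fin n => ν).real {z | r < ‖∑ i, F (z i)‖}
      ≤ Real.exp 1 := by
    refine le_trans ?_ (h3.trans (h2.trans h5))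
    gcongr
  rw [hτ2] at h7
  have h8 : 1 / (n * v) * r ^ 2
      * (Measure.pi fun _ : Fin n => ν).real {z | r < ‖∑ i, F (z i)‖} * (n * v)
      ≤ Real.exp 1 * (n * v) := by gcongr
  refine le_trans (le_of_eq ?_) h8
  field_simp

/-- For sσ ≤ 1, put w = |e|/σ: the integrand is at most 2(sσ)² e^{2w}, and E e^{2w} ≤ 2e² ≤ 15
yields the constant 30. For sσ ≥ 1, the bound 2 e^{(sσ)²/2} suffices because 2 ≤ e^{(sσ)²}. -/
theorem one_add_integral_exp_sub_le_of_subgaussian (he : HasSubgaussianMGF e (σ ^ 2) ν)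
    (hσ : 0 < σ) {s : ℝ} (hs : 0 ≤ s) :
    1 + ∫ z, (Real.exp (s * |e z|) - 1 - s * |e z|) ∂ν ≤ Real.exp (30 * (s * σ) ^ 2) := by
  have hσ' : (0 : ℝ) < σ := hσ
  have hint := integrable_exp_mul_abs_of_subgaussian he s
  have hint' : Integrable (fun z => Real.exp (s * |e z|) - 1 - s * |e z|) ν :=
    (hint.sub (integrable_const 1)).sub (he.integrable.abs.const_mul s)
  rcases le_total (s * σ) 1 with h | h
  · have hpt : ∀ z, Real.exp (s * |e z|) - 1 - s * |e z|
        ≤ 2 * (s * σ) ^ 2 * Real.exp (2 / σ * |e z|) := by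
      intro z
      set w := |e z| / σ with hw
      have hw0 : 0 ≤ w := by positivity
      have hy : s * |e z| = s * σ * w := by rw [hw]; field_simp
      have h1 : w ^ 2 ≤ 2 * Real.exp w := by
        have := Real.quadratic_le_exp_of_nonneg hw0
        linarith
      have h2 : Real.exp (s * σ * w) ≤ Real.exp w := by
        gcongr
        exact mul_le_of_le_one_left hw0 h
      have h3 : 2 / σ * |e z| = w + w := by rw [hw]; ring
      rw [h3, Real.exp_add, hy]
      calc Real.exp (s * σ * w) - 1 - s * σ * w
          ≤ (s * σ * w) ^ 2 * Real.exp (s * σ * w) :=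
            exp_sub_one_sub_id_le_sq_mul_exp (by positivity)
        _ ≤ (s * σ) ^ 2 * (2 * Real.exp w) * Real.exp w := by
            rw [mul_pow]; gcongr
        _ = _ := by ring
    have h4 := integral_mono hint' ((integrable_exp_mul_abs_of_subgaussian he (2 / σ)).const_mul
      (2 * (s * σ) ^ 2)) hpt
    rw [integral_const_mul] at h4
    have h5 := integral_exp_mul_abs_le_of_subgaussian he (2 / σ)
    have h6 : (2 / (σ : ℝ)) ^ 2 * σ ^ 2 / 2 = 1 + 1 := by field_simp; norm_num
    rw [h6, Real.exp_add] at h5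
    have h7 := Real.exp_one_lt_d9
    have h8 : ∫ z, Real.exp (2 / σ * |e z|) ∂ν ≤ 15 := by
      nlinarith [Real.exp_pos 1]
    have h9 : 2 * (s * σ) ^ 2 * ∫ z, Real.exp (2 / σ * |e z|) ∂ν ≤ 2 * (s * σ) ^ 2 * 15 := by
      gcongr
    linarith [Real.add_one_le_exp (30 * (s * σ) ^ 2)]
  · have h1 : ∫ z, (Real.exp (s * |e z|) - 1 - s * |e z|) ∂ν
        ≤ ∫ z, (Real.exp (s * |e z|) - 1) ∂ν := by
      refine integral_mono hint' (hint.sub (integrable_const 1)) fun z => ?_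
      have : 0 ≤ s * |e z| := by positivity
      simp only
      linarith
    rw [integral_sub hint (integrable_const 1)] at h1
    simp only [integral_const, probReal_univ, smul_eq_mul, mul_one] at h1
    have h2 := integral_exp_mul_abs_le_of_subgaussian he s
    have h3 : (2 : ℝ) ≤ Real.exp ((s * σ) ^ 2) := by
      have : 1 ≤ (s * σ) ^ 2 := one_le_pow₀ h
      linarith [Real.add_one_le_exp ((s * σ) ^ 2)]
    calc 1 + ∫ z, (Real.exp (s * |e z|) - 1 - s * |e z|) ∂ν
        ≤ 2 * Real.exp (s ^ 2 * σ ^ 2 / 2) := by linarith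
      _ ≤ Real.exp ((s * σ) ^ 2) * Real.exp (s ^ 2 * σ ^ 2 / 2) := by gcongr
      _ ≤ Real.exp (30 * (s * σ) ^ 2) := by
          rw [← Real.exp_add]
          gcongr
          nlinarith [sq_nonneg (s * σ)]

/-- Sub-Gaussian concentration for sums of independent centred vectors that are dominated by a
sub-Gaussian variable. -/
theorem pi_real_subgaussian_norm_sum_le (hF : StronglyMeasurable F) (hF0 : ∫ z, F z ∂ν = 0)
    (he : HasSubgaussianMGF e (σ ^ 2) ν) {κ : ℝ} (hκ : 0 ≤ κ) (hFe : ∀ z, ‖F z‖ ≤ κ * |e z|)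
    {n : ℕ} (hn : 1 ≤ n) {a C : ℝ} (ha : 0 < a) :
    (Measure.pi fun _ : Fin n => ν).real {z | C * (κ * σ * √(n * a)) < ‖∑ i, F (z i)‖}
      ≤ 2 * Real.exp (-(C - 30) * a) := by
  have hn0 : (0 : ℝ) < n := by exact_mod_cast hn
  have hFi : Integrable F ν := (he.integrable.abs.const_mul κ).mono' hF.aestronglyMeasurable
    (Filter.Eventually.of_forall hFe)
  -- In the degenerate case `F` vanishes almost everywhere; the choice of `τ` below divides by κσ.
  by_cases h0 : κ * σ = 0
  · have hzero : ∀ᵐ z ∂ν, F z = 0 := by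
      rcases mul_eq_zero.mp h0 with h | h
      · refine Filter.Eventually.of_forall fun z => ?_
        have := hFe z
        rw [h, zero_mul] at this
        exact norm_le_zero_iff.mp this
      · have hσ : σ = 0 := by exact_mod_cast h
        rw [hσ, zero_pow two_ne_zero] at he
        filter_upwards [he.ae_eq_zero_of_hasSubgaussianMGF_zero] with z hz
        have := hFe z
        rw [hz] at this
        exact norm_le_zero_iff.mp (by simpa using this)
    have hall : ∀ᵐ z ∂(Measure.pi fun _ : Fin n => ν), ∀ i, F (z i) = 0 :=
      ae_all_iff.mpr fun i => (measurePreserving_eval (fun _ : Fin n => ν) i).quasiMeasurePreserving.ae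
        hzero
    have : (Measure.pi fun _ : Fin n => ν).real {z | C * (κ * σ * √(n * a)) < ‖∑ i, F (z i)‖}
        = 0 := by
      rw [measureReal_eq_zero_iff]
      refine measure_mono_null (fun z hz => ?_) (ae_iff.mp hall)
      simp only [mem_ofPred_eq] at hz ⊢
      intro hz'
      simp [hz', h0] at hz
    rw [this]
    positivity
  · have hκ0 : 0 < κ := lt_of_le_of_ne hκ fun h => h0 (by rw [← h, zero_mul])
    have hσ0 : 0 < σ := lt_of_le_of_ne (zero_le) fun h => h0 (by rw [← h]; simp)
    have hσ0' : (0 : ℝ) < σ := hσ0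
    -- With this `τ` the log-moment term totals 30a and `τ` times the threshold is Ca.
    set τ := √a / (κ * σ * √n) with hτ
    have hsa : 0 < √a := Real.sqrt_pos.mpr ha
    have hsn : 0 < √(n : ℝ) := Real.sqrt_pos.mpr hn0
    have hτ0 : 0 < τ := by positivity
    have hexp : Integrable (fun z => Real.exp (τ * ‖F z‖)) ν := by
      refine (integrable_exp_mul_abs_of_subgaussian he (τ * κ)).mono' ?_
        (Filter.Eventually.of_forall fun z => ?_)
      · exact (Real.continuous_exp.comp_aestronglyMeasurable
          (hF.aestronglyMeasurable.norm.const_mul τ))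
      · rw [Real.norm_of_nonneg (Real.exp_pos _).le, mul_assoc]
        gcongr
        exact hFe z
    have hc : 1 + ∫ z, (Real.exp (τ * ‖F z‖) - 1 - τ * ‖F z‖) ∂ν
        ≤ Real.exp (30 * (τ * κ * σ) ^ 2) := by
      refine le_trans ?_ (one_add_integral_exp_sub_le_of_subgaussian he hσ0
        (s := τ * κ) (by positivity))
      refine add_le_add_right ?_ 1
      refine integral_mono ((hexp.sub (integrable_const 1)).sub (hFi.norm.const_mul τ))
        (((integrable_exp_mul_abs_of_subgaussian he _).sub (integrable_const 1)).sub
          (he.integrable.abs.const_mul _)) fun z => ?_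
      refine exp_sub_one_sub_id_mono (by positivity) ?_
      rw [mul_assoc]
      gcongr
      exact hFe z
    refine (pi_real_lt_norm_sum_le_exp hF hFi hF0 hτ0 hexp hc n).trans (le_of_eq ?_)
    congr 2
    have h1 : (τ * κ * σ) ^ 2 = a / n := by
      have : τ * κ * σ = √a / √n := by rw [hτ]; field_simp
      rw [this, div_pow, Real.sq_sqrt ha.le, Real.sq_sqrt hn0.le]
    have h2 : τ * (C * (κ * σ * √(n * a))) = C * a := by
      rw [hτ, Real.sqrt_mul hn0.le]
      field_simp
      rw [Real.sq_sqrt ha.le, mul_comm]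
    rw [h1, h2]
    field_simp
    ring

/-- Bernstein concentration for sums of independent centred bounded vectors. -/
theorem pi_real_bernstein_norm_sum_le (hF : StronglyMeasurable F) (hF0 : ∫ z, F z ∂ν = 0)
    {A q : ℝ} (hA : 0 ≤ A) (hq : 0 ≤ q) (hFb : ∀ z, ‖F z‖ ≤ A * (2 + q))
    (hsq : ∫ z, ‖F z‖ ^ 2 ∂ν ≤ A ^ 2) {n : ℕ} (hn : 1 ≤ n) {a₀ a : ℝ} (ha₀ : 0 < a₀)
    (ha : a₀ ≤ a) :
    (Measure.pi fun _ : Fin n => ν).real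
        {z | n * (A * ((6 + 5 / √a₀) * √(a / n) + 5 * q * (a / n))) < ‖∑ i, F (z i)‖}
      ≤ Real.exp (-a) / 2 := by
  have hn0 : (0 : ℝ) < n := by exact_mod_cast hn
  have ha' : 0 < a := ha₀.trans_le ha
  have hFi : Integrable F ν := .of_bound hF.aestronglyMeasurable _ (Filter.Eventually.of_forall hFb)
  have hFsq : Integrable (fun z => ‖F z‖ ^ 2) ν :=
    .of_bound (hF.norm.pow 2).aestronglyMeasurable ((A * (2 + q)) ^ 2)
      (Filter.Eventually.of_forall fun z => by
        rw [Real.norm_of_nonneg (by positivity)]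
        gcongr
        exact hFb z)
  set L := a / n with hL
  have hL0 : 0 < L := by positivity
  have hsL : 0 < √L := Real.sqrt_pos.mpr hL0
  have hs0 : 0 < √a₀ := Real.sqrt_pos.mpr ha₀
  have hLsq : √L ^ 2 = L := Real.sq_sqrt hL0.le
  -- Beyond the deterministic bound on the sum the event is empty. This settles `A = 0` and `L > 1`.
  have hempty : ∀ r : ℝ, n * (A * (2 + q)) ≤ r →
      (Measure.pi fun _ : Fin n => ν).real {z | r < ‖∑ i, F (z i)‖} ≤ Real.exp (-a) / 2 := by
    intro r hr
    have : {z : Fin n → Z | r < ‖∑ i, F (z i)‖} = ∅ := by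
      refine eq_empty_of_forall_notMem fun z hz => ?_
      have h1 : ‖∑ i, F (z i)‖ ≤ n * (A * (2 + q)) := by
        refine (norm_sum_le_of_le _ fun i _ => hFb (z i)).trans (le_of_eq ?_)
        simp
      exact absurd hz (not_lt.mpr (h1.trans hr))
    rw [this, measureReal_empty]
    positivity
  rcases hA.eq_or_lt with h | hA0
  · exact hempty _ (by simp [← h])
  rcases le_or_gt L 1 with hL1 | hL1
  swap
  · refine hempty _ ?_
    have h1 : 1 ≤ √L := Real.one_le_sqrt.mpr hL1.le
    have h2 : 2 ≤ (6 + 5 / √a₀) * √L := by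
      have : 0 ≤ 5 / √a₀ := by positivity
      nlinarith
    have h3 : q ≤ 5 * q * L := by nlinarith
    gcongr
  have hLs : L ≤ √L := Real.le_sqrt_of_sq_le (by nlinarith)
  have h5 : 0 < 5 / √a₀ := by positivity
  -- If e^{-a} < 1/4, an exponential tail 2e^{-2a} is already below e^{-a}/2. Otherwise only
  -- probability 1/8 is needed, which Chebyshev supplies at radius of order √(L/a₀).
  rcases lt_or_ge (Real.exp (-a)) (1 / 4) with h4 | h4
  -- The constraint τ(2 + q) ≤ 1 permits e^y - 1 - y ≤ y². The natural choice is √L, cut off at 1/(2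
  -- + q) when that is too large.
  · obtain ⟨τ, hτ0, hτb, hτ⟩ : ∃ τ : ℝ, 0 < τ ∧ τ * (2 + q) ≤ 1 ∧
        2 * L ≤ τ * ((6 + 5 / √a₀) * √L + 5 * q * L) - τ ^ 2 := by
      rcases le_or_gt (√L * (2 + q)) 1 with h | h
      · refine ⟨√L, hsL, h, ?_⟩
        have h6 : 0 ≤ √L * (5 / √a₀ * √L + 5 * q * L) := by positivity
        nlinarith
      · refine ⟨1 / (2 + q), by positivity, by field_simp; rfl, ?_⟩
        set τ := 1 / (2 + q) with hτ
        have hτ0 : 0 < τ := by positivity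
        have hτq : τ * (2 + q) = 1 := by rw [hτ]; field_simp
        have h6 : τ < √L := by
          rw [hτ, div_lt_iff₀ (by positivity)]
          exact h
        have h7 : τ ^ 2 ≤ L := by rw [← hLsq]; gcongr
        have h8 : 3 * L ≤ τ * ((6 + 5 / √a₀) * √L + 5 * q * L) := by
          calc 3 * L = τ * (6 * L + 3 * q * L) := by linear_combination (-3 * L) * hτq
            _ ≤ τ * ((6 + 5 / √a₀) * √L + 5 * q * L) := by
                gcongr
                · linarith
                · linarith
        linarith
    have hτA : ∀ z, τ / A * ‖F z‖ ≤ 1 := fun z => by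
      calc τ / A * ‖F z‖ ≤ τ / A * (A * (2 + q)) := by gcongr; exact hFb z
        _ = τ * (2 + q) := by field_simp
        _ ≤ 1 := hτb
    have hexp : Integrable (fun z => Real.exp (τ / A * ‖F z‖)) ν :=
      .of_bound (Real.continuous_exp.comp_aestronglyMeasurable
        (hF.aestronglyMeasurable.norm.const_mul _)) (Real.exp 1)
        (Filter.Eventually.of_forall fun z => by
          rw [Real.norm_of_nonneg (Real.exp_pos _).le]
          gcongr
          exact hτA z)
    have hc : 1 + ∫ z, (Real.exp (τ / A * ‖F z‖) - 1 - τ / A * ‖F z‖) ∂ν ≤ Real.exp (τ ^ 2) := by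
      have h6 : ∫ z, (Real.exp (τ / A * ‖F z‖) - 1 - τ / A * ‖F z‖) ∂ν
          ≤ ∫ z, (τ / A) ^ 2 * ‖F z‖ ^ 2 ∂ν := by
        refine integral_mono ((hexp.sub (integrable_const 1)).sub (hFi.norm.const_mul _))
          (hFsq.const_mul _) fun z => ?_
        have h7 : 0 ≤ τ / A * ‖F z‖ := by positivity
        have := Real.abs_exp_sub_one_sub_id_le (x := τ / A * ‖F z‖)
          (by rw [abs_of_nonneg h7]; exact hτA z)
        rw [mul_pow] at this
        exact (le_abs_self _).trans this
      rw [integral_const_mul] at h6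
      have h7 : (τ / A) ^ 2 * ∫ z, ‖F z‖ ^ 2 ∂ν ≤ (τ / A) ^ 2 * A ^ 2 := by gcongr
      have h8 : (τ / A) ^ 2 * A ^ 2 = τ ^ 2 := by field_simp
      linarith [Real.add_one_le_exp (τ ^ 2)]
    refine (pi_real_lt_norm_sum_le_exp hF hFi hF0 (by positivity) hexp hc n).trans ?_
    have h6 : n * τ ^ 2 - τ / A * (n * (A * ((6 + 5 / √a₀) * √L + 5 * q * L))) ≤ -a + -a := by
      have h7 : τ / A * (n * (A * ((6 + 5 / √a₀) * √L + 5 * q * L)))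
          = n * (τ * ((6 + 5 / √a₀) * √L + 5 * q * L)) := by field_simp
      have h8 : n * (2 * L) = a + a := by rw [hL]; field_simp; ring
      rw [h7]
      nlinarith
    calc 2 * Real.exp _ ≤ 2 * Real.exp (-a + -a) := by gcongr
      _ = 2 * (Real.exp (-a) * Real.exp (-a)) := by rw [Real.exp_add]
      _ ≤ Real.exp (-a) / 2 := by nlinarith [Real.exp_pos (-a)]
  · set r := n * (A * (5 / √a₀ * √L)) with hr
    have hr0 : 0 < r := by positivity
    have h6 : (Measure.pi fun _ : Fin n => ν).real
        {z | n * (A * ((6 + 5 / √a₀) * √L + 5 * q * L)) < ‖∑ i, F (z i)‖}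
        ≤ (Measure.pi fun _ : Fin n => ν).real {z | r < ‖∑ i, F (z i)‖} := by
      refine measureReal_mono fun z hz => lt_of_le_of_lt (b := n * (A * ((6 + 5 / √a₀) * √L + 5 * q * L))) ?_ hz
      rw [hr]
      gcongr
      have : 0 ≤ 5 * q * L := by positivity
      nlinarith
    refine h6.trans ((pi_real_lt_norm_sum_le_div hF hFi hF0 (by positivity) hr0 hFsq hsq hn).trans ?_)
    have h7 : r ^ 2 = n * A ^ 2 * (25 * (a / a₀)) := by
      rw [hr, mul_pow, mul_pow, mul_pow, div_pow, hLsq, Real.sq_sqrt ha₀.le, hL]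
      field_simp
      norm_num
    have h8 : 1 ≤ a / a₀ := (one_le_div ha₀).mpr ha
    rw [h7, div_le_iff₀ (by positivity)]
    have h9 : Real.exp 1 ≤ 25 / 8 * (a / a₀) := by linarith [Real.exp_one_lt_d9]
    calc Real.exp 1 * (n * A ^ 2) ≤ 25 / 8 * (a / a₀) * (n * A ^ 2) := by gcongr
      _ = (1 / 4) / 2 * (n * A ^ 2 * (25 * (a / a₀))) := by ring
      _ ≤ Real.exp (-a) / 2 * (n * A ^ 2 * (25 * (a / a₀))) := by gcongr

end Tails

/-! ### Population and empirical normal equations. -/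

section Regularization

theorem integral_inner_mul_eq {E : Type*} [MeasurableSpace E] {H : Type*} [NormedAddCommGroup H]
    [InnerProductSpace ℝ H] [CompleteSpace H] {S : Set E} {P : Measure E} {Φ : E → H} {k : E → E → ℝ}
    (hk : ∀ x ∈ S, ∀ x' ∈ S, inner ℝ (Φ x) (Φ x') = k x x') (hP : ∀ᵐ x ∂P, x ∈ S) {g : E → ℝ}
    (hg : Integrable (fun x => g x • Φ x) P) {x : E} (hx : x ∈ S) :
    ∫ x', k x x' * g x' ∂P = inner ℝ (Φ x) (∫ x', g x' • Φ x' ∂P) := by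
  rw [← integral_inner hg]
  refine integral_congr_ae ?_
  filter_upwards [hP] with x' hx'
  rw [real_inner_smul_right, hk x hx x' hx', mul_comm]

variable {E : Type*} [MetricSpace E] [MeasurableSpace E] [BorelSpace E]
  {H : Type*} [NormedAddCommGroup H] [InnerProductSpace ℝ H]

theorem ContinuousOn.integrable_of_ae_mem_isCompact {F : Type*} [NormedAddCommGroup F]
    {S : Set E} (hS : IsCompact S) {P : Measure E} [IsFiniteMeasure P] (hP : ∀ᵐ x ∂P, x ∈ S)
    {f : E → F} (hf : ContinuousOn f S) : Integrable f P := by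
  have := hf.integrableOn_compact (μ := P) hS
  rwa [IntegrableOn, Measure.restrict_eq_self_of_ae_mem hP] at this

/-- Functions are controlled on `S` only, so they are cut off outside it to be measurable globally.
The target need not be separable; compactness of `S` takes its place. -/
theorem ContinuousOn.stronglyMeasurable_indicator {F : Type*} [NormedAddCommGroup F]
    {S : Set E} (hS : IsCompact S) {f : E → F} (hf : ContinuousOn f S) :
    StronglyMeasurable (S.indicator f) := by
  have : CompactSpace S := isCompact_iff_compactSpace.mp hS
  have h := (MeasurableEmbedding.subtype_coe hS.measurableSet).stronglyMeasurable_extend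
    hf.domRestrict.stronglyMeasurable (g' := (0 : E → F)) stronglyMeasurable_zero
  convert h using 1
  ext x
  by_cases hx : x ∈ S
  · rw [indicator_of_mem hx]
    exact (Subtype.val_injective.extend_apply (S.domRestrict f) 0 ⟨x, hx⟩).symm
  · rw [indicator_of_notMem hx, Function.extend_apply']
    · rfl
    · rintro ⟨y, rfl⟩; exact hx y.2

variable {S : Set E} {P : Measure E} [IsProbabilityMeasure P] {Φ : E → H} {f₀ : E → ℝ} {lam : ℝ}

/-- The regularized normal equation `(T + lam) u = ∫ f₀ Φ dP` has a solution. -/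
theorem exists_regularized_normal_eq [CompleteSpace H] (hS : IsCompact S) (hP : ∀ᵐ x ∂P, x ∈ S)
    (hΦ : ContinuousOn Φ S) (hlam : 0 < lam) (b : H) :
    ∃ u : H, ∫ x, inner ℝ (Φ x) u • Φ x ∂P + lam • u = b := by
  let R : E → H →L[ℝ] H := fun x => (innerSL ℝ (Φ x)).smulRight (Φ x)
  have hR : Integrable R P := by
    refine ContinuousOn.integrable_of_ae_mem_isCompact hS hP ?_
    have h1 : ContinuousOn (fun x => innerSL ℝ (Φ x)) S := (innerSL ℝ).continuous.comp_continuousOn hΦ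
    exact ((ContinuousLinearMap.smulRightL ℝ H H).continuous₂.comp_continuousOn (h1.prodMk hΦ))
  let T : H →L[ℝ] H := ∫ x, R x ∂P + lam • ContinuousLinearMap.id ℝ H
  have hRapp : ∀ v, (∫ x, R x ∂P) v = ∫ x, inner ℝ (Φ x) v • Φ x ∂P := fun v => by
    rw [ContinuousLinearMap.integral_apply hR]
    rfl
  have hRv : ∀ v, Integrable (fun x => inner ℝ (Φ x) v • Φ x) P := fun v =>
    hR.apply_continuousLinearMap v
  -- Lax–Milgram: the form of T + λ is coercive with constant λ, since the integral of rank-one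
  -- operators is positive.
  let B : H →L[ℝ] H →L[ℝ] ℝ := LinearMap.mkContinuous₂
    (LinearMap.mk₂ ℝ (fun u v => inner ℝ (T u) v)
      (fun u u' v => by rw [map_add, inner_add_left])
      (fun c u v => by rw [map_smul, real_inner_smul_left, smul_eq_mul])
      (fun u v v' => by rw [inner_add_right])
      (fun c u v => by rw [real_inner_smul_right, smul_eq_mul])) ‖T‖
    (fun u v => (norm_inner_le_norm _ _).trans (by
      gcongr
      exact T.le_opNorm u))
  have hBapp : ∀ u v, B u v = inner ℝ (T u) v := fun u v => rfl
  have hB : IsCoercive B := by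
    refine ⟨lam, hlam, fun u => ?_⟩
    have h1 : inner ℝ ((∫ x, R x ∂P) u) u = ∫ x, inner ℝ (Φ x) u ^ 2 ∂P := by
      rw [hRapp, real_inner_comm, ← integral_inner (hRv u)]
      refine integral_congr_ae (Filter.Eventually.of_forall fun x => ?_)
      simp only
      rw [real_inner_smul_right, real_inner_comm, sq]
    have h2 : 0 ≤ ∫ x, inner ℝ (Φ x) u ^ 2 ∂P := integral_nonneg fun x => sq_nonneg _
    rw [hBapp]
    simp only [T, FunLike.coe_add, Pi.add_apply, inner_add_left, h1, smul_apply,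
      ContinuousLinearMap.id_apply, real_inner_smul_left, real_inner_self_eq_norm_sq]
    nlinarith
  refine ⟨hB.continuousLinearEquivOfBilin.symm b, ?_⟩
  set u := hB.continuousLinearEquivOfBilin.symm b
  have h1 : T u = b := by
    refine ext_inner_right ℝ fun w => ?_
    rw [← hBapp, ← hB.continuousLinearEquivOfBilin_apply u w]
    simp [u]
  rw [← h1, ← hRapp]
  rfl

/-- Size of the solution of the regularized normal equation. -/
theorem norm_le_and_integral_sq_le_of_normal_eq [CompleteSpace H] (hS : IsCompact S)
    (hP : ∀ᵐ x ∂P, x ∈ S) (hΦ : ContinuousOn Φ S) (hf₀ : ContinuousOn f₀ S) (hlam : 0 < lam) {u : H}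
    (hu : ∫ x, inner ℝ (Φ x) u • Φ x ∂P + lam • u = ∫ x, f₀ x • Φ x ∂P) {M : ℝ} (hM : 0 ≤ M)
    (hfM : ∀ x ∈ S, |f₀ x| ≤ M) :
    ‖u‖ ≤ M / (2 * √lam) ∧ ∫ x, (f₀ x - inner ℝ (Φ x) u) ^ 2 ∂P ≤ M ^ 2 := by
  have hl : ContinuousOn (fun x => inner ℝ (Φ x) u) S := hΦ.inner continuousOn_const
  have hi1 : Integrable (fun x => inner ℝ (Φ x) u • Φ x) P :=
    (hl.smul hΦ).integrable_of_ae_mem_isCompact hS hP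
  have hi2 : Integrable (fun x => f₀ x • Φ x) P :=
    (hf₀.smul hΦ).integrable_of_ae_mem_isCompact hS hP
  have hi3 : Integrable (fun x => inner ℝ (Φ x) u ^ 2) P :=
    (hl.pow 2).integrable_of_ae_mem_isCompact hS hP
  have hi4 : Integrable (fun x => f₀ x * inner ℝ (Φ x) u) P :=
    (hf₀.mul hl).integrable_of_ae_mem_isCompact hS hP
  have hi5 : Integrable (fun x => f₀ x ^ 2) P :=
    (hf₀.pow 2).integrable_of_ae_mem_isCompact hS hP
  -- The normal equation paired with `u`. With fl - l² ≤ f²/4 for l = ⟪Φ ·, u⟫, it gives λ‖u‖² ≤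
  -- M²/4.
  have h1 : ∫ x, inner ℝ (Φ x) u ^ 2 ∂P + lam * ‖u‖ ^ 2 = ∫ x, f₀ x * inner ℝ (Φ x) u ∂P := by
    have := congrArg (inner ℝ u) hu
    rw [inner_add_right, ← integral_inner hi1, ← integral_inner hi2, real_inner_smul_right,
      real_inner_self_eq_norm_sq] at this
    simp only [real_inner_smul_right, real_inner_comm] at this
    simpa only [sq, real_inner_comm] using this
  have h2 : ∫ x, f₀ x ^ 2 ∂P ≤ M ^ 2 := by
    have : ∫ x, f₀ x ^ 2 ∂P ≤ ∫ _, M ^ 2 ∂P := by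
      refine integral_mono_ae hi5 (integrable_const _) ?_
      filter_upwards [hP] with x hx
      exact sq_le_sq' (abs_le.mp (hfM x hx)).1 (abs_le.mp (hfM x hx)).2
    simpa using this
  have h3 : ∫ x, f₀ x * inner ℝ (Φ x) u ∂P - ∫ x, inner ℝ (Φ x) u ^ 2 ∂P
      ≤ (1 / 4) * ∫ x, f₀ x ^ 2 ∂P := by
    rw [← integral_sub hi4 hi3, ← integral_const_mul]
    refine integral_mono (hi4.sub hi3) (hi5.const_mul _) fun x => ?_
    simp only
    nlinarith [sq_nonneg (f₀ x / 2 - inner ℝ (Φ x) u)]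
  constructor
  · have h4 : (2 * √lam * ‖u‖) ^ 2 ≤ M ^ 2 := by
      rw [mul_pow, mul_pow, Real.sq_sqrt hlam.le]
      linarith
    rw [le_div_iff₀ (by positivity), mul_comm]
    exact (sq_le_sq₀ (by positivity) hM).mp h4
  · have h4 : ∫ x, (f₀ x - inner ℝ (Φ x) u) ^ 2 ∂P = ∫ x, f₀ x ^ 2 ∂P
        - 2 * ∫ x, f₀ x * inner ℝ (Φ x) u ∂P + ∫ x, inner ℝ (Φ x) u ^ 2 ∂P := by
      rw [← integral_const_mul, ← integral_sub hi5 (hi4.const_mul 2),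
        ← integral_add (f := fun x => f₀ x ^ 2 - 2 * (f₀ x * inner ℝ (Φ x) u))
          (hi5.sub (hi4.const_mul 2)) hi3]
      refine integral_congr_ae (Filter.Eventually.of_forall fun x => ?_)
      simp only
      ring
    have h5 : 0 ≤ ∫ x, inner ℝ (Φ x) u ^ 2 ∂P := integral_nonneg fun x => sq_nonneg _
    have h6 : 0 ≤ lam * ‖u‖ ^ 2 := by positivity
    linarith

/-- `-lam` is not an eigenvalue of a positive semidefinite integral operator. -/
theorem eqOn_zero_of_integral_eq_neg_mul [CompleteSpace H] (hS : IsCompact S)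
    (hP : ∀ᵐ x ∂P, x ∈ S) (hΦ : ContinuousOn Φ S) (hlam : 0 < lam) {k : E → E → ℝ}
    (hk : ∀ x ∈ S, ∀ x' ∈ S, inner ℝ (Φ x) (Φ x') = k x x') {h : E → ℝ} (hh : ContinuousOn h S)
    (heq : ∀ x ∈ S, ∫ x', k x x' * h x' ∂P + lam * h x = 0) : EqOn h 0 S := by
  have hi : Integrable (fun x => h x • Φ x) P :=
    (hh.smul hΦ).integrable_of_ae_mem_isCompact hS hP
  set w := ∫ x, h x • Φ x ∂P with hw
  have h1 : ∀ x ∈ S, inner ℝ (Φ x) w = -lam * h x := fun x hx => by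
    have := heq x hx
    rw [integral_inner_mul_eq hk hP hi hx] at this
    linarith
  -- Thus ‖w‖² is nonpositive, so w = 0, and `h1` then forces h = 0 on all of `S`, not merely almost
  -- everywhere.
  have h2 : inner ℝ w w = -lam * ∫ x, h x ^ 2 ∂P := by
    conv_lhs => rw [hw, ← hw]
    rw [show inner ℝ w w = inner ℝ w (∫ x, h x • Φ x ∂P) from rfl, ← integral_inner hi,
      ← integral_const_mul]
    refine integral_congr_ae ?_
    filter_upwards [hP] with x hx
    rw [real_inner_smul_right, real_inner_comm, h1 x hx]
    ring
  have h3 : 0 ≤ ∫ x, h x ^ 2 ∂P := integral_nonneg fun x => sq_nonneg _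
  have h4 : w = 0 := by
    have : inner ℝ w w ≤ 0 := by rw [h2]; nlinarith
    exact real_inner_self_nonpos.mp this
  intro x hx
  have := h1 x hx
  rw [h4, inner_zero_right] at this
  have h5 : lam * h x = 0 := by linarith
  exact (mul_eq_zero.mp h5).resolve_left hlam.ne'

/-- The ridge estimator differs from the population solution `u` by at most the normalized residual
of its normal equation. -/
theorem norm_ridge_sub_le {n : ℕ} (hn : 1 ≤ n) (hlam : 0 < lam) (φ : Fin n → H) {c y : Fin n → ℝ}
    (hc : ∀ i, inner ℝ (φ i) (∑ j, c j • φ j) + n * lam * c i = y i) (u : H) :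
    ‖∑ j, c j • φ j - u‖ ≤ ‖∑ i, ((y i - inner ℝ (φ i) u) • φ i - lam • u)‖ / (n * lam) := by
  have hn0 : (0 : ℝ) < n := by exact_mod_cast hn
  set w := ∑ j, c j • φ j - u with hw
  set R := ∑ i, ((y i - inner ℝ (φ i) u) • φ i - lam • u) with hR
  have h1 : ∑ i, inner ℝ (φ i) w • φ i + (n * lam) • w = R := by
    have h2 : ∀ i, (y i - inner ℝ (φ i) u) • φ i
        = inner ℝ (φ i) w • φ i + (n * lam) • (c i • φ i) := fun i => by
      rw [hw, inner_sub_right, smul_smul, ← add_smul, ← hc i]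
      congr 1
      ring
    rw [hR, Finset.sum_sub_distrib, Finset.sum_congr rfl fun i _ => h2 i, Finset.sum_add_distrib,
      ← Finset.smul_sum, hw]
    simp only [Finset.sum_const, Finset.card_univ, Fintype.card_fin, smul_sub]
    rw [← Nat.cast_smul_eq_nsmul ℝ, smul_smul]
    abel
  -- Dropping the nonnegative sum and using Cauchy–Schwarz leaves nλ‖w‖² ≤ ‖R‖‖w‖.
  have h2 : ∑ i, inner ℝ (φ i) w ^ 2 + n * lam * ‖w‖ ^ 2 = inner ℝ R w := by
    rw [← h1, inner_add_left, sum_inner, real_inner_smul_left, real_inner_self_eq_norm_sq]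
    simp only [real_inner_smul_left, sq]
  have h3 : 0 ≤ ∑ i, inner ℝ (φ i) w ^ 2 := Finset.sum_nonneg fun i _ => sq_nonneg _
  have h4 := real_inner_le_norm R w
  rw [le_div_iff₀ (by positivity)]
  rcases (norm_nonneg w).eq_or_lt with h | h
  · rw [← h, zero_mul]; exact norm_nonneg _
  · nlinarith

/-- The coefficients of kernel ridge regression solve its normal equation. -/
theorem ridge_coeff_normal_eq {n : ℕ} (hn : 1 ≤ n) (hlam : 0 < lam) (φ : Fin n → H)
    (y : Fin n → ℝ) (i : Fin n) :
    inner ℝ (φ i) (∑ j, (Matrix.mulVec (Matrix.of (fun i j => inner ℝ (φ i) (φ j))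
        + ((n : ℝ) * lam) • (1 : Matrix (Fin n) (Fin n) ℝ))⁻¹ y) j • φ j)
      + n * lam * (Matrix.mulVec (Matrix.of (fun i j => inner ℝ (φ i) (φ j))
        + ((n : ℝ) * lam) • (1 : Matrix (Fin n) (Fin n) ℝ))⁻¹ y) i = y i := by
  have hn0 : (0 : ℝ) < n := by exact_mod_cast hn
  set A : Matrix (Fin n) (Fin n) ℝ := Matrix.of (fun i j => inner ℝ (φ i) (φ j))
    + ((n : ℝ) * lam) • (1 : Matrix (Fin n) (Fin n) ℝ) with hA
  have hpos : A.PosDef :=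
    Matrix.PosDef.posSemidef_add (Matrix.posSemidef_gram ℝ φ)
      (Matrix.PosDef.one.smul (by positivity))
  have hunit : IsUnit A.det := hpos.det_pos.ne'.isUnit
  set c := Matrix.mulVec A⁻¹ y
  have h1 : Matrix.mulVec A c = y := by
    rw [Matrix.mulVec_mulVec, Matrix.mul_nonsing_inv _ hunit, Matrix.one_mulVec]
  have h2 := congrFun h1 i
  rw [← h2, hA, Matrix.add_mulVec, Matrix.smul_mulVec, Matrix.one_mulVec]
  simp [Matrix.mulVec, dotProduct, inner_sum, real_inner_smul_right, mul_comm]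

end Regularization

/-! ### Concentration of the residual R. -/

section Residual

variable {d n : ℕ} {S : Set (Fin d → ℝ)} {H : Type*} [NormedAddCommGroup H] [InnerProductSpace ℝ H]
  {Ω : Type*} [MeasurableSpace Ω] {μ : Measure Ω}
  {P₀ : Measure ((Fin d → ℝ) × ℝ)} {f₀ : (Fin d → ℝ) → ℝ} {σ : ℝ≥0}
  {X : Fin n → Ω → Fin d → ℝ} {y : Fin n → Ω → ℝ}

namespace IsRegressionSample

theorem isProbabilityMeasure [IsProbabilityMeasure μ]
    (h : IsRegressionSample μ S P₀ f₀ σ X y) (i : Fin n) :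
    IsProbabilityMeasure P₀ := by
  rw [← h.law i]
  exact Measure.isProbabilityMeasure_map ((h.measurable_X i).prodMk (h.measurable_y i)).aemeasurable

theorem ae_fst_mem (h : IsRegressionSample μ S P₀ f₀ σ X y) (hS : MeasurableSet S) (i : Fin n) :
    ∀ᵐ z ∂P₀, z.1 ∈ S := by
  rw [← h.law i, ae_map_iff ((h.measurable_X i).prodMk (h.measurable_y i)).aemeasurable
    (measurable_fst hS)]
  exact Filter.Eventually.of_forall fun ω => h.mem i ω

theorem hasSubgaussianMGF_residual (h : IsRegressionSample μ S P₀ f₀ σ X y)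
    (hf : Measurable (S.indicator f₀)) (i : Fin n) :
    HasSubgaussianMGF (fun z : (Fin d → ℝ) × ℝ => z.2 - S.indicator f₀ z.1) (σ ^ 2) P₀ := by
  have hZ : Measurable fun ω => (X i ω, y i ω) := (h.measurable_X i).prodMk (h.measurable_y i)
  have he : Measurable fun z : (Fin d → ℝ) × ℝ => z.2 - S.indicator f₀ z.1 :=
    measurable_snd.sub (hf.comp measurable_fst)
  have heq : (fun ω => y i ω - f₀ (X i ω))
      = (fun z : (Fin d → ℝ) × ℝ => z.2 - S.indicator f₀ z.1) ∘ fun ω => (X i ω, y i ω) := by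
    ext ω
    simp [indicator_of_mem (h.mem i ω)]
  refine (h.subgaussian i).congr_identDistrib ⟨?_, he.aemeasurable, ?_⟩
  · rw [heq]; exact (he.comp hZ).aemeasurable
  · rw [heq, ← Measure.map_map he hZ, h.law i]

variable [IsProbabilityMeasure μ]

/-- Pairing the mean `v` with itself gives ‖v‖² = E[ε ⟪v, φ(X)⟫], and the X-measurable factor pulls
out of the conditional expectation of ε. Only scalar conditional expectations are needed. -/
theorem integral_residual_smul_eq_zero [CompleteSpace H]
    (h : IsRegressionSample μ S P₀ f₀ σ X y) (hf : Measurable (S.indicator f₀)) (i : Fin n)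
    {φ : (Fin d → ℝ) → H} (hφ : StronglyMeasurable φ) {κ : ℝ} (hφκ : ∀ x, ‖φ x‖ ≤ κ) :
    ∫ z : (Fin d → ℝ) × ℝ, (z.2 - S.indicator f₀ z.1) • φ z.1 ∂P₀ = 0 := by
  have hZ : Measurable fun ω => (X i ω, y i ω) := (h.measurable_X i).prodMk (h.measurable_y i)
  have he : Measurable fun z : (Fin d → ℝ) × ℝ => z.2 - S.indicator f₀ z.1 :=
    measurable_snd.sub (hf.comp measurable_fst)
  have hF : StronglyMeasurable fun z : (Fin d → ℝ) × ℝ => (z.2 - S.indicator f₀ z.1) • φ z.1 :=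
    he.stronglyMeasurable.smul (hφ.comp_measurable measurable_fst)
  rw [← h.law i, integral_map hZ.aemeasurable hF.aestronglyMeasurable]
  have heq : ∀ ω, (y i ω - S.indicator f₀ (X i ω)) • φ (X i ω)
      = (y i ω - f₀ (X i ω)) • φ (X i ω) := fun ω => by rw [indicator_of_mem (h.mem i ω)]
  simp only [heq]
  have hε : Integrable (fun ω => y i ω - f₀ (X i ω)) μ := (h.subgaussian i).integrable
  have hφX : StronglyMeasurable fun ω => φ (X i ω) := hφ.comp_measurable (h.measurable_X i)
  have hint : Integrable (fun ω => (y i ω - f₀ (X i ω)) • φ (X i ω)) μ :=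
    hε.smul_bdd κ hφX.aestronglyMeasurable (Filter.Eventually.of_forall fun ω => hφκ _)
  set v := ∫ ω, (y i ω - f₀ (X i ω)) • φ (X i ω) ∂μ with hv
  have hm : MeasurableSpace.comap (X i) inferInstance ≤ ‹MeasurableSpace Ω› :=
    (h.measurable_X i).comap_le
  have hg : StronglyMeasurable[MeasurableSpace.comap (X i) inferInstance]
      fun ω => inner ℝ v (φ (X i ω)) :=
    (stronglyMeasurable_const.inner hφ).comp_measurable (comap_measurable (X i))
  have hpull := condExp_stronglyMeasurable_mul_of_bound hm hg hε (‖v‖ * κ)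
    (Filter.Eventually.of_forall fun ω => (norm_inner_le_norm _ _).trans (by gcongr; exact hφκ _))
  have hzero : inner ℝ v v = 0 := by
    conv_lhs => rw [hv, ← hv]
    rw [show inner ℝ v v = inner ℝ v (∫ ω, (y i ω - f₀ (X i ω)) • φ (X i ω) ∂μ) from rfl,
      ← integral_inner hint]
    simp only [real_inner_smul_right]
    have h1 : ∀ ω, (y i ω - f₀ (X i ω)) * inner ℝ v (φ (X i ω))
        = ((fun ω => inner ℝ v (φ (X i ω))) * fun ω => y i ω - f₀ (X i ω)) ω := fun ω => mul_comm _ _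
    simp only [h1]
    rw [← integral_condExp hm]
    refine integral_eq_zero_of_ae ?_
    filter_upwards [hpull, h.regression i] with ω h2 h3
    rw [h2, Pi.mul_apply, h3, Pi.zero_apply, mul_zero]
  exact inner_self_eq_zero.mp hzero

/-- Concentration of the residual of the empirical normal equation at the population solution. -/
theorem real_lt_norm_sum_residual_le [CompleteSpace H]
    (h : IsRegressionSample μ S P₀ f₀ σ X y) (hn : 1 ≤ n) (hS : IsCompact S)
    {Φ : (Fin d → ℝ) → H} (hΦ : ContinuousOn Φ S) (hf₀ : ContinuousOn f₀ S) {κ M lam : ℝ}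
    (hκ : 0 ≤ κ) (hΦκ : ∀ x ∈ S, ‖Φ x‖ ≤ κ) (hM : 0 ≤ M) (hfM : ∀ x ∈ S, |f₀ x| ≤ M)
    (hσM : σ ≤ M) (hlam : 0 < lam) {u : H}
    (hu : ∫ x, inner ℝ (Φ x) u • Φ x ∂P₀.fst + lam • u = ∫ x, f₀ x • Φ x ∂P₀.fst) {a₀ a : ℝ}
    (ha₀ : 0 < a₀) (ha : a₀ ≤ a) :
    μ.real {ω | n * (κ * M * ((37 + 2 / a₀ + 5 / √a₀) * √(a / n) + 5 * (κ / √lam) * (a / n)))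
      < ‖∑ i, ((y i ω - inner ℝ (Φ (X i ω)) u) • Φ (X i ω) - lam • u)‖} ≤ Real.exp (-a) := by
  have hn0 : (0 : ℝ) < n := by exact_mod_cast hn
  have ha' : 0 < a := ha₀.trans_le ha
  let i₀ : Fin n := ⟨0, hn⟩
  have := h.isProbabilityMeasure i₀
  have hZ : ∀ i, Measurable fun ω => (X i ω, y i ω) := fun i =>
    (h.measurable_X i).prodMk (h.measurable_y i)
  have hPS' := h.ae_fst_mem hS.measurableSet i₀
  have hPS : ∀ᵐ x ∂P₀.fst, x ∈ S := by
    exact (ae_map_iff measurable_fst.aemeasurable hS.measurableSet).mpr hPS'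
  obtain ⟨hunorm, hul2⟩ := norm_le_and_integral_sq_le_of_normal_eq hS hPS hΦ hf₀ hlam hu hM hfM
  set q := κ / √lam with hq
  have hq0 : 0 ≤ q := by positivity
  set l : (Fin d → ℝ) → ℝ := fun x => inner ℝ (Φ x) u with hl
  have hlc : ContinuousOn l S := hΦ.inner continuousOn_const
  have hgc : ContinuousOn (fun x => f₀ x - l x) S := hf₀.sub hlc
  set φ := S.indicator Φ with hφ
  set g := S.indicator fun x => f₀ x - l x with hg
  have hφm : StronglyMeasurable φ := hΦ.stronglyMeasurable_indicator hS
  have hfm : Measurable (S.indicator f₀) := (hf₀.stronglyMeasurable_indicator hS).measurable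
  have hgm : StronglyMeasurable g := hgc.stronglyMeasurable_indicator hS
  have hφκ : ∀ x, ‖φ x‖ ≤ κ := fun x => by
    by_cases hx : x ∈ S
    · rw [hφ, indicator_of_mem hx]; exact hΦκ x hx
    · rw [hφ, indicator_of_notMem hx, norm_zero]; exact hκ
  have hlM : ∀ x ∈ S, |f₀ x - l x| ≤ M * (1 + q / 2) := fun x hx => by
    have h1 : |l x| ≤ κ * (M / (2 * √lam)) :=
      (abs_real_inner_le_norm _ _).trans (mul_le_mul (hΦκ x hx) hunorm (norm_nonneg _) hκ)
    calc |f₀ x - l x| ≤ |f₀ x| + |l x| := abs_sub _ _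
      _ ≤ M + κ * (M / (2 * √lam)) := add_le_add (hfM x hx) h1
      _ = M * (1 + q / 2) := by rw [hq]; field_simp
  have hgM : ∀ x, |g x| ≤ M * (1 + q / 2) := fun x => by
    by_cases hx : x ∈ S
    · rw [hg, indicator_of_mem hx]; exact hlM x hx
    · rw [hg, indicator_of_notMem hx, abs_zero]; positivity
  have hgφ : ∀ x, ‖g x • φ x‖ ≤ κ * M * (1 + q / 2) := fun x => by
    rw [norm_smul, Real.norm_eq_abs]
    calc |g x| * ‖φ x‖ ≤ M * (1 + q / 2) * κ := by gcongr; exacts [hgM x, hφκ x]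
      _ = _ := by ring
  have hgφm : StronglyMeasurable fun x => g x • φ x := hgm.smul hφm
  -- The noise part; `F₂` below is the bounded part, centred because the normal equation says E G =
  -- λu.
  let F₁ : (Fin d → ℝ) × ℝ → H := fun z => (z.2 - S.indicator f₀ z.1) • φ z.1
  have hF₁m : StronglyMeasurable F₁ :=
    (measurable_snd.sub (hfm.comp measurable_fst)).stronglyMeasurable.smul
      (hφm.comp_measurable measurable_fst)
  have hF₁b : ∀ z, ‖F₁ z‖ ≤ κ * |z.2 - S.indicator f₀ z.1| := fun z => by
    rw [norm_smul, Real.norm_eq_abs, mul_comm]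
    gcongr
    exact hφκ _
  let G : (Fin d → ℝ) × ℝ → H := fun z => g z.1 • φ z.1
  have hGm : StronglyMeasurable G :=
    (hgm.comp_measurable measurable_fst).smul (hφm.comp_measurable measurable_fst)
  have hGi : Integrable G P₀ := .of_bound hGm.aestronglyMeasurable _
    (Filter.Eventually.of_forall fun z => hgφ z.1)
  have hGint : ∫ z, G z ∂P₀ = lam • u := by
    have h1 : ∫ z, G z ∂P₀ = ∫ x, g x • φ x ∂P₀.fst :=
      (integral_map measurable_fst.aemeasurable hgφm.aestronglyMeasurable).symm
    have h2 : ∫ x, g x • φ x ∂P₀.fst = ∫ x, (f₀ x • Φ x - inner ℝ (Φ x) u • Φ x) ∂P₀.fst := by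
      refine integral_congr_ae ?_
      filter_upwards [hPS] with x hx
      rw [hg, hφ, indicator_of_mem hx, indicator_of_mem hx, sub_smul]
    rw [h1, h2, integral_sub (f := fun x => f₀ x • Φ x) (g := fun x => inner ℝ (Φ x) u • Φ x)
      ((hf₀.smul hΦ).integrable_of_ae_mem_isCompact hS hPS)
      ((hlc.smul hΦ).integrable_of_ae_mem_isCompact hS hPS), ← hu, add_sub_cancel_left]
  let F₂ : (Fin d → ℝ) × ℝ → H := fun z => G z - lam • u
  have hF₂m : StronglyMeasurable F₂ := hGm.sub stronglyMeasurable_const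
  have hF₂0 : ∫ z, F₂ z ∂P₀ = 0 := by
    rw [integral_sub hGi (integrable_const _), hGint]
    simp
  have hlu : ‖lam • u‖ ≤ κ * M * (1 + q / 2) := by
    rw [← hGint]
    have := norm_integral_le_of_norm_le_const (μ := P₀)
      (Filter.Eventually.of_forall fun z => hgφ z.1)
    simpa using this
  have hF₂b : ∀ z, ‖F₂ z‖ ≤ κ * M * (2 + q) := fun z => by
    refine (norm_sub_le _ _).trans ((add_le_add (hgφ z.1) hlu).trans (le_of_eq ?_))
    ring
  have hF₂sq : ∫ z, ‖F₂ z‖ ^ 2 ∂P₀ ≤ (κ * M) ^ 2 := by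
    have hGsq : Integrable (fun z => ‖G z‖ ^ 2) P₀ :=
      .of_bound (hGm.norm.pow 2).aestronglyMeasurable ((κ * M * (1 + q / 2)) ^ 2)
        (Filter.Eventually.of_forall fun z => by
          rw [Real.norm_of_nonneg (by positivity)]
          gcongr
          exact hgφ _)
    have hGin : Integrable (fun z => inner ℝ (lam • u) (G z)) P₀ := hGi.const_inner _
    -- Variance is at most the second moment, so the bound (κM)² is free of λ; the cruder sup bound
    -- κM(2 + q) is not.
    have h1 : ∫ z, ‖F₂ z‖ ^ 2 ∂P₀ = ∫ z, ‖G z‖ ^ 2 ∂P₀ - ‖lam • u‖ ^ 2 := by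
      have h2 : ∀ z, ‖F₂ z‖ ^ 2 = ‖G z‖ ^ 2 - 2 * inner ℝ (lam • u) (G z) + ‖lam • u‖ ^ 2 :=
        fun z => by rw [norm_sub_sq_real, real_inner_comm]
      simp only [h2]
      rw [integral_add (f := fun z => ‖G z‖ ^ 2 - 2 * inner ℝ (lam • u) (G z)) (hGsq.sub (hGin.const_mul 2)) (integrable_const _),
        integral_sub hGsq (hGin.const_mul 2), integral_const_mul, integral_inner hGi, hGint,
        real_inner_self_eq_norm_sq]
      simp
      ring
    have h3 : ∫ z, ‖G z‖ ^ 2 ∂P₀ ≤ κ ^ 2 * ∫ x, (f₀ x - l x) ^ 2 ∂P₀.fst := by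
      have hgi : Integrable (fun x => (f₀ x - l x) ^ 2) P₀.fst :=
        (hgc.pow 2).integrable_of_ae_mem_isCompact hS hPS
      have h4 : ∫ z, ‖G z‖ ^ 2 ∂P₀ = ∫ x, ‖g x • φ x‖ ^ 2 ∂P₀.fst :=
        (integral_map measurable_fst.aemeasurable (hgφm.norm.pow 2).aestronglyMeasurable).symm
      have h5 : Integrable (fun x => ‖g x • φ x‖ ^ 2) P₀.fst :=
        .of_bound (hgφm.norm.pow 2).aestronglyMeasurable ((κ * M * (1 + q / 2)) ^ 2)
          (Filter.Eventually.of_forall fun z => by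
            rw [Real.norm_of_nonneg (by positivity)]
            gcongr
            exact hgφ _)
      rw [h4, ← integral_const_mul]
      refine integral_mono_ae h5 (hgi.const_mul _) ?_
      filter_upwards [hPS] with x hx
      rw [norm_smul, mul_pow, Real.norm_eq_abs, sq_abs, hg, indicator_of_mem hx, mul_comm]
      gcongr
      exact hφκ x
    rw [h1, mul_pow]
    have h6 : κ ^ 2 * ∫ x, (f₀ x - l x) ^ 2 ∂P₀.fst ≤ κ ^ 2 * M ^ 2 := by gcongr
    linarith [sq_nonneg ‖lam • u‖]
  have hA : 0 ≤ κ * M := by positivity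
  -- The factor 31 + 2/a₀ exceeds 30 by 1 + 2/a₀, so the tail is at most 2e^{-a-2} ≤ e^{-a}/2. The
  -- other half goes to `F₂`.
  have hb₁ := (real_lt_norm_sum_eq_pi hZ h.indep h.law hF₁m
    ((31 + 2 / a₀) * (κ * σ * √(n * a)))).trans_le (pi_real_subgaussian_norm_sum_le hF₁m
    (h.integral_residual_smul_eq_zero hfm i₀ hφm hφκ) (h.hasSubgaussianMGF_residual hfm i₀) hκ hF₁b
    hn ha')
  have hb₂ := (real_lt_norm_sum_eq_pi hZ h.indep h.law hF₂m _).trans_le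
    (pi_real_bernstein_norm_sum_le hF₂m hF₂0 hA hq0 hF₂b hF₂sq hn ha₀ ha)
  have hexp : 2 * Real.exp (-(31 + 2 / a₀ - 30) * a) ≤ Real.exp (-a) / 2 := by
    have h1 : -(31 + 2 / a₀ - 30) * a ≤ -a + -2 := by
      have : 1 ≤ a / a₀ := (one_le_div ha₀).mpr ha
      have h2 : 2 / a₀ * a = 2 * (a / a₀) := by ring
      nlinarith
    have h2 : Real.exp (-2) ≤ 1 / 4 := by
      rw [Real.exp_neg, inv_eq_one_div]
      refine one_div_le_one_div_of_le (by norm_num) ?_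
      rw [show (2 : ℝ) = 1 + 1 by norm_num, Real.exp_add]
      nlinarith [Real.exp_one_gt_d9]
    calc 2 * Real.exp (-(31 + 2 / a₀ - 30) * a) ≤ 2 * Real.exp (-a + -2) := by gcongr
      _ = 2 * Real.exp (-a) * Real.exp (-2) := by rw [Real.exp_add]; ring
      _ ≤ 2 * Real.exp (-a) * (1 / 4) := by gcongr
      _ = _ := by ring
  refine (measureReal_mono ?_).trans ((measureReal_union_le _ _).trans
    ((add_le_add (hb₁.trans hexp) hb₂).trans (by linarith)))
  intro ω hω
  by_contra hcon
  simp only [mem_union, mem_ofPred_eq, not_or, not_lt] at hcon hω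
  have hsum : ∑ i, ((y i ω - inner ℝ (Φ (X i ω)) u) • Φ (X i ω) - lam • u)
      = ∑ i, F₁ (X i ω, y i ω) + ∑ i, F₂ (X i ω, y i ω) := by
    rw [← Finset.sum_add_distrib]
    refine Finset.sum_congr rfl fun i _ => ?_
    simp only [F₁, F₂, G, hg, hφ, indicator_of_mem (h.mem i ω), hl]
    rw [← add_sub_assoc, ← add_smul]
    congr 2
    ring
  rw [hsum] at hω
  have h1 : (31 + 2 / a₀) * (κ * σ * √(n * a)) ≤ n * (κ * M * ((31 + 2 / a₀) * √(a / n))) := by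
    have h2 : √(n * a) = n * √(a / n) := by
      rw [Real.sqrt_mul hn0.le, Real.sqrt_div ha'.le]
      have := Real.mul_self_sqrt hn0.le
      have h3 : √(n : ℝ) ≠ 0 := (Real.sqrt_pos.mpr hn0).ne'
      field_simp
      rw [Real.sq_sqrt hn0.le]
    rw [h2]
    calc (31 + 2 / a₀) * (κ * σ * (n * √(a / n)))
        ≤ (31 + 2 / a₀) * (κ * M * (n * √(a / n))) := by gcongr
      _ = _ := by ring
  have h2 := norm_add_le (∑ i, F₁ (X i ω, y i ω)) (∑ i, F₂ (X i ω, y i ω))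
  have h3 : n * (κ * M * ((37 + 2 / a₀ + 5 / √a₀) * √(a / n) + 5 * q * (a / n)))
      = n * (κ * M * ((31 + 2 / a₀) * √(a / n)))
        + n * (κ * M * ((6 + 5 / √a₀) * √(a / n) + 5 * q * (a / n))) := by ring
  linarith [hcon.1, hcon.2]

end IsRegressionSample

end Residual

/-! ### Sup norms of continuous functions on `S`. -/

section SupNorm

variable {d : ℕ} {S : Set (Fin d → ℝ)}

theorem abs_le_supNormOn (hS : IsCompact S) {f : (Fin d → ℝ) → ℝ} (hf : ContinuousOn f S)
    {x : Fin d → ℝ} (hx : x ∈ S) : |f x| ≤ supNormOn S f := by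
  have hb := hS.bddAbove_image hf.abs
  refine le_ciSup (f := fun x : S => |f x|) ?_ ⟨x, hx⟩
  rwa [image_eq_range] at hb

theorem supNormOn_le (hne : S.Nonempty) {f : (Fin d → ℝ) → ℝ} {B : ℝ} (h : ∀ x ∈ S, |f x| ≤ B) :
    supNormOn S f ≤ B :=
  have := hne.to_subtype
  ciSup_le fun x => h x x.2

/-- Applied to `W 0` and `W β` this bounds feature norms by κ and κ_β. Continuity on compact `S`
makes the supremum a genuine one rather than the default 0. -/
theorem norm_le_sqrt_iSup (hS : IsCompact S) {H : Type*} [NormedAddCommGroup H]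
    [InnerProductSpace ℝ H] {V : (Fin d → ℝ) → H} (hV : ContinuousOn V S)
    {k : (Fin d → ℝ) → ℝ} (hk : ∀ x ∈ S, inner ℝ (V x) (V x) = k x) {x : Fin d → ℝ} (hx : x ∈ S) :
    ‖V x‖ ≤ √(⨆ x : S, k x) := by
  have hkn : ∀ x ∈ S, k x = ‖V x‖ ^ 2 := fun x hx => by
    rw [← hk x hx, real_inner_self_eq_norm_sq]
  have hkc : ContinuousOn k S := (hV.norm.pow 2).congr hkn
  have hb := hS.bddAbove_image hkc
  rw [image_eq_range] at hb
  refine Real.le_sqrt_of_sq_le ?_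
  rw [← hkn x hx]
  exact le_ciSup (f := fun x : S => k x) hb ⟨x, hx⟩

end SupNorm

/-! ### Representation by vectors of `H`, and assembly of the theorem. -/

/-- Elements of the Hilbert space of a smooth feature map represent functions in `C^m`. -/
theorem isCm_and_mixedPartialOn_of_featureMap {d m : ℕ} {S : Set (Fin d → ℝ)}
    (hS : closure (interior S) = S) {H : Type*} [NormedAddCommGroup H] [InnerProductSpace ℝ H]
    {W : (Fin d → ℕ) → (Fin d → ℝ) → H} (hWc : ∀ β, ∑ i, β i ≤ m → ContinuousOn (W β) S)
    (hWd : ∀ (β : Fin d → ℕ) (j : Fin d), ∑ i, (β + Pi.single j 1 : Fin d → ℕ) i ≤ m →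
      ∀ x ∈ interior S, HasLineDerivAt ℝ (W β) (W (β + Pi.single j 1) x) x (Pi.single j 1))
    {f : (Fin d → ℝ) → ℝ} {h : H} (hf : ∀ x ∈ S, f x = inner ℝ (W 0 x) h) :
    IsCm S m f ∧ ∀ β, ∑ i, β i ≤ m → EqOn (mixedPartialOn S β f) (fun x => inner ℝ (W β x) h) S := by
  have h0 : EqOn (fun x => inner ℝ (W 0 x) h) f S := fun x hx => (hf x hx).symm
  have hc : ∀ β, ∑ i, β i ≤ m → ContinuousOn (fun x => inner ℝ (W β x) h) S := fun β hβ =>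
    (hWc β hβ).inner continuousOn_const
  have hd : ∀ (β : Fin d → ℕ) (j : Fin d), ∑ i, (β + Pi.single j 1 : Fin d → ℕ) i ≤ m →
      ∀ x ∈ interior S, HasLineDerivAt ℝ (fun x => inner ℝ (W β x) h)
        (inner ℝ (W (β + Pi.single j 1) x) h) x (Pi.single j 1) := fun β j hβ x hx =>
    (hWd β j hβ x hx).inner_const h
  exact ⟨⟨fun β x => inner ℝ (W β x) h, h0, hc, hd⟩, fun β hβ =>
    mixedPartialOn_eqOn (D := fun β x => inner ℝ (W β x) h) hS h0 hc hd hβ⟩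

theorem mainTheorem3 (δ₀ : ℝ) (hδ₀ : 0 < δ₀) (hδ₀' : δ₀ < 1) :
    ∃ C : ℝ, 0 < C ∧
      ∀ (d m n : ℕ), 1 ≤ n →
      ∀ (S : Set (Fin d → ℝ)), IsCompact S → closure (interior S) = S →
      ∀ (K : (Fin d → ℝ) → (Fin d → ℝ) → ℝ), IsMercerKernel S K → IsC2m S m K →
      ∀ (f₀ : (Fin d → ℝ) → ℝ), IsCm S m f₀ →
      ∀ (σ : ℝ≥0) (lam : ℝ), 0 < lam →
      ∀ (P₀ : Measure ((Fin d → ℝ) × ℝ)),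
      ∀ (Ω : Type*) [MeasurableSpace Ω] (μ : Measure Ω) [IsProbabilityMeasure μ]
        (X : Fin n → Ω → Fin d → ℝ) (y : Fin n → Ω → ℝ),
        IsRegressionSample μ S P₀ f₀ σ X y →
        (∀ ω, IsCm S m (krr K lam (fun i => X i ω) (fun i => y i ω))) ∧
        ∃ fl : (Fin d → ℝ) → ℝ,
          IsRegularized S P₀.fst K lam f₀ fl ∧
          (∀ g, IsRegularized S P₀.fst K lam f₀ g → EqOn g fl S) ∧
          IsCm S m fl ∧
          ∀ (β : Fin d → ℕ), ∑ i, β i ≤ m → ∀ δ : ℝ, 0 < δ → δ ≤ δ₀ →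
            1 - δ ≤ μ.real {ω |
              supNormOn S (fun x =>
                mixedPartialOn S β (krr K lam (fun i => X i ω) (fun i => y i ω)) x
                  - mixedPartialOn S β f₀ x)
              ≤ supNormOn S (fun x => mixedPartialOn S β fl x - mixedPartialOn S β f₀ x)
                + 2 * kappa S K * kappaDeriv S β K * max (supNormOn S f₀) σ
                    * Real.sqrt (Real.log (1 / δ)) / (Real.sqrt n * lam)
                  * (10 + 2 * C
                    + 8 * kappa S K * Real.sqrt (Real.log (1 / δ))
                      / (3 * Real.sqrt (n * lam)))} := by
  set a₀ := Real.log (1 / δ₀) with ha₀_def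
  have ha₀ : 0 < a₀ := Real.log_pos ((one_lt_div hδ₀).mpr hδ₀')
  have hs₀ : 0 < √a₀ := Real.sqrt_pos.mpr ha₀
  -- All that is needed is 37 + 2/a₀ + 5/√a₀ ≤ 2(10 + 2C).
  refine ⟨10 + 2 / a₀ + 5 / √a₀, by positivity, ?_⟩
  intro d m n hn S hSc hS K hK hKm f₀ hf₀ σ lam hlam P₀ Ω _ μ _ X y h
  have hn0 : (0 : ℝ) < n := by exact_mod_cast hn
  let i₀ : Fin n := ⟨0, hn⟩
  have := h.isProbabilityMeasure i₀
  obtain ⟨ω₀⟩ : Nonempty Ω := nonempty_of_isProbabilityMeasure μ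
  have hne : S.Nonempty := ⟨_, h.mem i₀ ω₀⟩
  obtain ⟨H, _, _, _, W, hWc, hWd, hWW, hW0⟩ := exists_smooth_featureMap hS hK hKm
  have hΦ : ContinuousOn (W 0) S := hWc 0 (by simp)
  have hrep : ∀ {f : (Fin d → ℝ) → ℝ} {v : H}, (∀ x ∈ S, f x = inner ℝ (W 0 x) v) →
      IsCm S m f ∧ ∀ β, ∑ i, β i ≤ m →
        EqOn (mixedPartialOn S β f) (fun x => inner ℝ (W β x) v) S := fun hf =>
    isCm_and_mixedPartialOn_of_featureMap hS hWc hWd hf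
  obtain ⟨D, hD0, hDc, hDd⟩ := hf₀
  have hf₀c : ContinuousOn f₀ S := (hDc 0 (by simp)).congr hD0.symm
  have hPS : ∀ᵐ x ∂P₀.fst, x ∈ S :=
    (ae_map_iff measurable_fst.aemeasurable hSc.measurableSet).mpr
      (h.ae_fst_mem hSc.measurableSet i₀)
  have hf₀i : Integrable (fun x => f₀ x • W 0 x) P₀.fst :=
    (hf₀c.smul hΦ).integrable_of_ae_mem_isCompact hSc hPS
  obtain ⟨u, hu⟩ := exists_regularized_normal_eq hSc hPS hΦ hlam (∫ x, f₀ x • W 0 x ∂P₀.fst)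
  have hlc : ContinuousOn (fun x => inner ℝ (W 0 x) u) S := hΦ.inner continuousOn_const
  have hli : Integrable (fun x => inner ℝ (W 0 x) u • W 0 x) P₀.fst :=
    (hlc.smul hΦ).integrable_of_ae_mem_isCompact hSc hPS
  have hreg : IsRegularized S P₀.fst K lam f₀ fun x => inner ℝ (W 0 x) u := by
    refine ⟨hlc, fun x hx => ?_⟩
    rw [integralOp, integralOp, integral_inner_mul_eq hW0 hPS hf₀i hx,
      integral_inner_mul_eq hW0 hPS hli hx, ← hu, inner_add_right, real_inner_smul_right]
  let c : Ω → Fin n → ℝ := fun ω => Matrix.mulVec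
    (Matrix.of (fun i j => inner ℝ (W 0 (X i ω)) (W 0 (X j ω)))
      + ((n : ℝ) * lam) • (1 : Matrix (Fin n) (Fin n) ℝ))⁻¹ fun i => y i ω
  have hkrr : ∀ ω, ∀ x ∈ S, krr K lam (fun i => X i ω) (fun i => y i ω) x
      = inner ℝ (W 0 x) (∑ j, c ω j • W 0 (X j ω)) := by
    intro ω x hx
    simp only [krr, c, dotProduct, inner_sum, real_inner_smul_right, hW0 _ (h.mem _ ω) _ (h.mem _ ω),
      hW0 x hx _ (h.mem _ ω), mul_comm]
  refine ⟨fun ω => (hrep (hkrr ω)).1, fun x => inner ℝ (W 0 x) u, hreg, fun g hg x hx => ?_,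
    (hrep fun x _ => rfl).1, ?_⟩
  · have hsub := eqOn_zero_of_integral_eq_neg_mul hSc hPS hΦ hlam hW0
      (h := fun x => g x - inner ℝ (W 0 x) u) (hg.1.sub hlc) (fun x hx => by
      have hgi : Integrable (fun x => g x • W 0 x) P₀.fst :=
        (hg.1.smul hΦ).integrable_of_ae_mem_isCompact hSc hPS
      have h1 := hg.2 x hx
      have h2 := hreg.2 x hx
      rw [integralOp, integral_inner_mul_eq hW0 hPS hgi hx] at h1
      rw [integralOp, integral_inner_mul_eq hW0 hPS hli hx] at h2
      rw [integral_inner_mul_eq hW0 hPS (g := fun x => g x - inner ℝ (W 0 x) u)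
        (((hg.1.sub hlc).smul hΦ).integrable_of_ae_mem_isCompact hSc hPS) hx]
      simp only [sub_smul]
      rw [integral_sub hgi hli, inner_sub_right]
      linarith) hx
    exact sub_eq_zero.mp hsub
  intro β hβ δ hδ hδδ₀
  set a := Real.log (1 / δ) with ha_def
  have ha : a₀ ≤ a := Real.log_le_log (by positivity) (one_div_le_one_div_of_le hδ hδδ₀)
  have ha' : 0 < a := ha₀.trans_le ha
  set κ := kappa S K with hκ_def
  set M := max (supNormOn S f₀) (σ : ℝ) with hM_def
  have hκ : 0 ≤ κ := Real.sqrt_nonneg _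
  have hM : 0 ≤ M := σ.2.trans (le_max_right _ _)
  have hconc := h.real_lt_norm_sum_residual_le hn hSc hΦ hf₀c hκ
    (fun x hx => norm_le_sqrt_iSup hSc hΦ (k := fun x => K x x) (fun x hx => hW0 x hx x hx) hx) hM
    (fun x hx => (abs_le_supNormOn hSc hf₀c hx).trans (le_max_left _ _)) (le_max_right _ _) hlam hu
    ha₀ ha
  rw [show Real.exp (-a) = δ by rw [ha_def, one_div, Real.log_inv, neg_neg, Real.exp_log hδ]]
    at hconc
  -- Subadditivity replaces the complement rule, so the event need not be shown measurable.
  have hcover : ∀ A B : Set Ω, Bᶜ ⊆ A → μ.real B ≤ δ → 1 - δ ≤ μ.real A := by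
    intro A B hAB hB
    have h1 : μ.real univ ≤ μ.real A + μ.real B :=
      (measureReal_mono fun ω _ => (em (ω ∈ B)).elim Or.inr fun hω => Or.inl (hAB hω)).trans
        (measureReal_union_le _ _)
    rw [probReal_univ] at h1
    linarith
  refine hcover _ _ (fun ω hω => ?_) hconc
  simp only [mem_compl_iff, mem_ofPred_eq, not_lt] at hω ⊢
  set fh : H := ∑ j, c ω j • W 0 (X j ω)
  have hw : ‖fh - u‖ ≤ _ := norm_ridge_sub_le hn hlam (fun i => W 0 (X i ω))
    (ridge_coeff_normal_eq hn hlam (fun i => W 0 (X i ω)) fun i => y i ω) u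
  replace hw := hw.trans (div_le_div_of_nonneg_right hω (by positivity))
  have hκβ : 0 ≤ kappaDeriv S β K := Real.sqrt_nonneg _
  have hD := mixedPartialOn_eqOn hS hD0 hDc hDd hβ
  have hfl := (hrep (f := fun x => inner ℝ (W 0 x) u) fun x _ => rfl).2 β hβ
  have hfh := (hrep (hkrr ω)).2 β hβ
  have hflc : ContinuousOn (fun x => mixedPartialOn S β (fun x => inner ℝ (W 0 x) u) x
      - mixedPartialOn S β f₀ x) S :=
    (((hWc β hβ).inner continuousOn_const).congr hfl).sub ((hDc β hβ).congr hD)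
  have hsup : supNormOn S (fun x =>
      mixedPartialOn S β (krr K lam (fun i => X i ω) (fun i => y i ω)) x - mixedPartialOn S β f₀ x)
      ≤ supNormOn S (fun x => mixedPartialOn S β (fun x => inner ℝ (W 0 x) u) x
        - mixedPartialOn S β f₀ x) + kappaDeriv S β K * ‖fh - u‖ := by
    refine supNormOn_le hne fun x hx => ?_
    have h1 := abs_le_supNormOn hSc hflc hx
    have h2 : |inner ℝ (W β x) (fh - u)| ≤ kappaDeriv S β K * ‖fh - u‖ :=
      (abs_real_inner_le_norm _ _).trans (by
        gcongr
        exact norm_le_sqrt_iSup hSc (hWc β hβ) (k := fun x => kernelPartialOn S β K (x, x))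
          (fun x hx => hWW β hβ x hx x hx) hx)
    -- β enters the stochastic error only here, through `W β x`; the good event itself does not
    -- depend on β.
    have h3 : mixedPartialOn S β (krr K lam (fun i => X i ω) (fun i => y i ω)) x
        - mixedPartialOn S β f₀ x = (mixedPartialOn S β (fun x => inner ℝ (W 0 x) u) x
          - mixedPartialOn S β f₀ x) + inner ℝ (W β x) (fh - u) := by
      rw [hfh hx, hfl hx, inner_sub_right]
      ring
    rw [h3]
    exact (abs_add_le _ _).trans (add_le_add h1 h2)
  refine hsup.trans (add_le_add_right ?_ _)
  have hsn : 0 < √(n : ℝ) := Real.sqrt_pos.mpr hn0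
  have hsl : 0 < √lam := Real.sqrt_pos.mpr hlam
  have hsa : 0 < √a := Real.sqrt_pos.mpr ha'
  calc kappaDeriv S β K * ‖fh - u‖
      ≤ kappaDeriv S β K * (n * (κ * M * ((37 + 2 / a₀ + 5 / √a₀) * √(a / n)
          + 5 * (κ / √lam) * (a / n))) / (n * lam)) := by gcongr
    _ = kappaDeriv S β K * (κ * M * √a / (√n * lam)
          * ((37 + 2 / a₀ + 5 / √a₀) + 5 * (κ * √a / (√n * √lam)))) := by
        rw [Real.sqrt_div ha'.le]
        nth_rewrite 2 [← Real.sq_sqrt ha'.le]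
        nth_rewrite 3 [← Real.sq_sqrt hn0.le]
        field_simp
    -- The factor 2 in front of the stated bound is moved inside, so the second-order term only
    -- needs 5 ≤ 2 · 8/3.
    _ ≤ kappaDeriv S β K * (κ * M * √a / (√n * lam)
          * (2 * (10 + 2 * (10 + 2 / a₀ + 5 / √a₀))
            + 16 / 3 * (κ * √a / (√n * √lam)))) := by
        have h1 : 0 ≤ 2 / a₀ := by positivity
        have h2 : 0 ≤ 5 / √a₀ := by positivity
        gcongr
        · linarith
        · norm_num
    _ = _ := by
        rw [Real.sqrt_mul hn0.le]
        field_simp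
        ring
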